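/- Let $0<\rho<1$. Consider the $M/M/1$ processor sharing queue with arrival rate $\rho$ and unit service rate, and a tagged customer arriving at time $0$. Let $N_k$ be the number of customers other than the tagged one just after the $k$-th event (arrival or departure), with $N_0$ the number of customers found upon arrival, the chain being absorbed in a state $-1$ when the tagged customer leaves. Thus $(N_k)_{k\ge 0}$ is a Markov chain on $\{-1,0,1,2,\dots\}$ with non-zero transition probabilities $\mathcal A_{-1,-1}=1$ and, for $j\ge 0$, $$\mathcal A_{j,-1}=\frac{1}{(j+1)(1+\rho)},\qquad \mathcal A_{j,j-1}=\frac{j}{(j+1)(1+\rho)}\ (j\ge 1),\qquad \mathcal A_{j,j+1}=\frac{\rho}{1+\rho}.$$ Let $\kappa=\min\{k: N_k=-1\}$ be the number of events up to and including the departure of the tagged customer, and let $\nu=N_{\kappa-1}$ be the number of customers it leaves behind. Let $P_j$ be the Pollaczek polynomials given by $P_{-1}=0$, $P_0=1$ and $(j+1)P_{j+1}(y)-2(j+1)\,y\,P_j(y)+jP_{j-1}(y)=0$ for $j\ge 0$. Put $c=\frac{2\sqrt\rho}{1+\rho}$, $Q_j(x)=\rho^{-j/2}P_j(x/c)$ and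 $\mathcal Q(x;z)=\sum_{j\ge 0}Q_j(x)z^j$. Let $\psi$ be the measure on $[-c,c]$ with density $$\frac{d\psi}{dx}(x)=\frac{1+\rho}{\sqrt\rho}\,w(x/c),\qquad w(\cos\theta)=\frac{e^{(2\theta-\pi)\tau}}{2\cosh(\pi\tau)},\quad \tau=\frac{\cos\theta}{2\sin\theta},\quad \theta\in(0,\pi).$$ Let $n\ge 0$ with $\mathbb P(N_0=n)>0$. Then the series $\mathcal Q(x;\rho)$ converges for every $x\in[-c,c]$, the integrands below are $\psi$-integrable, and for all integers $m\ge 0$ and $k\ge 1$, $$\mathbb P(\nu=m\mid N_0=n)=\frac{\rho^m}{1+\rho}\int_{-c}^{c}\frac{Q_m(x)Q_n(x)}{1-x}\,d\psi(x),$$ $$\mathbb P(\kappa=k\mid N_0=n)=\frac{1}{1+\rho}\int_{-c}^{c}x^{k-1}\mathcal Q(x;\rho)Q_n(x)\,d\psi(x),$$ $$\mathbb P(\kappa=k,\ \nu=m\mid N_0=n)=\frac{\rho^m}{1+\rho}\int_{-c}^{c}x^{k-1}Q_m(x)Q_n(x)\,d\psi(x).$$ -/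

import Mathlib

open MeasureTheory ProbabilityTheory Set

noncomputable section

/-- A discrete-time process `N` on `(Ω, P)` with values in a countable state space `S` is a
(time-homogeneous) Markov chain with transition matrix `p`:
`P(N_{k+1} = t, N_k = s_k, …, N_0 = s_0) = P(N_k = s_k, …, N_0 = s_0) p(s_k, t)`. -/
structure IsMarkovChain {Ω : Type*} [MeasurableSpace Ω] (P : Measure Ω) {S : Type*}
    (p : Matrix S S ℝ) (N : ℕ → Ω → S) : Prop where
  measurableSet_eq : ∀ (k : ℕ) (s : S), MeasurableSet {ω | N k ω = s}
  markov : ∀ (k : ℕ) (s : ℕ → S) (t : S),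
    P.real {ω | (∀ i ≤ k, N i ω = s i) ∧ N (k + 1) ω = t} =
      P.real {ω | ∀ i ≤ k, N i ω = s i} * p (s k) t

/-- The transition matrix of the number of customers other than the tagged one in an `M/M/1`
processor sharing queue (arrival rate `ρ`, service rate `1`), observed at arrivals and departures.
The state space is `{-1, 0, 1, 2, …}`: `some n` means that `n` other customers are present, and
`none` is the absorbing state `-1`, entered when the tagged customer leaves. -/
def psMatrix (ρ : ℝ) : Matrix (Option ℕ) (Option ℕ) ℝ
  | none, none => 1
  | none, some _ => 0
  | some n, none => 1 / ((n + 1) * (1 + ρ))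
  | some n, some m =>
      if m = n + 1 then ρ / (1 + ρ)
      else if m + 1 = n then n / ((n + 1) * (1 + ρ))
      else 0

/-- `κ`: the number of events (arrivals and departures, including the departure of the tagged
customer) until the tagged customer leaves, i.e. the first time the chain is in the absorbing
state; it is `⊤` if this never happens. -/
def departureIndex {Ω : Type*} (N : ℕ → Ω → Option ℕ) : Ω → WithTop ℕ :=
  hittingAfter N {none} 0

/-- `ν`: the number of customers left behind by the tagged customer, i.e. the state of the chain
just before absorption. On the event that absorption never occurs, it is `none`. -/
def leftBehind {Ω : Type*} (N : ℕ → Ω → Option ℕ) (ω : Ω) : Option ℕ :=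
  match departureIndex N ω with
  | none => none
  | some k => N (k - 1) ω

/-- The value at `x` of the Pollaczek polynomial `P_n(x; a, b)`: `P_{-1} = 0`, `P_0 = 1`,
`(n+1) P_{n+1} - ((2n+1+a) x + b) P_n + n P_{n-1} = 0`. -/
def pollaczek (a b x : ℝ) : ℕ → ℝ
  | 0 => 1
  | 1 => (1 + a) * x + b
  | n + 2 =>
      (((2 * (n + 1 : ℝ) + 1 + a) * x + b) * pollaczek a b x (n + 1)
        - (n + 1 : ℝ) * pollaczek a b x n) / (n + 2 : ℝ)

/-- The weight `w(x; a, b)` of the Pollaczek polynomials on `[-1, 1]`. -/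
def pollaczekWeight (a b x : ℝ) : ℝ :=
  let θ := Real.arccos x
  let τ := (a * Real.cos θ + b) / (2 * Real.sin θ)
  1 / (2 * Real.cosh (Real.pi * τ)) * Real.exp ((2 * θ - Real.pi) * τ)

/-- `Q_n(x) = ρ^{-n/2} P_n((1+ρ) x / (2 √ρ); 1, 0)`. -/
def psQ (ρ : ℝ) (n : ℕ) (x : ℝ) : ℝ :=
  1 / √ρ ^ n * pollaczek 1 0 ((1 + ρ) / (2 * √ρ) * x) n

/-- The generating function `𝒬(x; z) = ∑ Q_n(x) z^n`. -/
def psGen (ρ x z : ℝ) : ℝ := ∑' n : ℕ, psQ ρ n x * z ^ n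

/-- The interval `[-2√ρ/(1+ρ), 2√ρ/(1+ρ)]`. -/
def psSupport (ρ : ℝ) : Set ℝ := Icc (-(2 * √ρ / (1 + ρ))) (2 * √ρ / (1 + ρ))

/-- The measure `ψ` on the interval `[-2√ρ/(1+ρ), 2√ρ/(1+ρ)]`, with density
`(1+ρ)/√ρ · w((1+ρ) x / (2√ρ); 1, 0)`. -/
def psMeasure (ρ : ℝ) : Measure ℝ :=
  (volume.restrict (psSupport ρ)).withDensity fun x =>
    ENNReal.ofReal ((1 + ρ) / √ρ * pollaczekWeight 1 0 ((1 + ρ) / (2 * √ρ) * x))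

end

/-!
Two ingredients are combined: the weight of the Pollaczek polynomials `P_n(x; 1, 0)` makes them
orthogonal, and multiplication by `x` acts on the `Q_n` as the transition matrix of the chain.

*From orthogonality to the queue.* The relation
`x Q_m = ρ/(1+ρ) Q_{m+1} + m/((m+1)(1+ρ)) Q_{m-1}` (`mul_psQ`) and
`∫ Q_m Q_n dψ = δ_{mn} / (ρ^n (n+1))` (`integral_psQ_mul_psQ`) show by induction on `k` that the
`k`-step probability from `n` to `m` before absorption is `ρ^m (m+1) ∫ x^k Q_m Q_n dψ`
(`measureReal_aliveFrom_eq`). One more step, from `m` to the absorbing state, has probability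
`1/((m+1)(1+ρ))`, which gives the joint law of `κ` and `ν`. Its marginals are sums of a geometric
series in `x` (the support of `ψ` lies inside `(-1, 1)`) and of the generating function of the
`Q_m`, which converges uniformly on the support because the polynomials grow subexponentially on
`[-1, 1]` (`exists_pollaczek_bound`).

*Orthogonality.* By the recurrence it suffices that `∫ P_m w = 0` for `m ≥ 1` and `∫ w = 1/2`,
that is, that the integral of `∑ P_m z^m` against `w` is `1/2` for all `|z| < 1`. Put
`x = cos θ` and `u = cot θ`, so that `w = e^{θu} / (1 + e^{πu})`, and let `a` be the angle under
which `e^{iθ}` is seen from `z`. The generating function is `(sin a / sin θ) e^{(a-θ)u}`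
(`tsum_pollaczek_eq_pollaczekGen`), so the integral in question is
`∫ sin a · e^{au} / (1 + e^{πu}) dθ` over `(0, π)`. A contour integral over a strip of height `π`
gives `e^{au} / (1 + e^{πu}) = (1/π) ∫_0^∞ Re (i e^{iru} / sinh (r + ia)) dr`
(`exp_div_one_add_exp_eq_integral`). After the integrals over `r` and `θ` are exchanged, the
integrand is, as a function of `θ`, the real part of the boundary values of a function analytic in
the unit disc: the factor `e^{iru}` becomes `exp (-r (1+ζ²)/(1-ζ²))`, bounded in the disc, and the
denominator has no zero there. The mean value property (`circleAverage_discFunction`) evaluates the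
inner integral to `π e^{-2r}`, whatever `z` is, and `∫_0^∞ e^{-2r} dr = 1/2`.
-/

/-! ### The polynomials `P_n(x; 1, 0)` on `[-1, 1]` -/

lemma pollaczek_one_zero_succ_succ (x : ℝ) (j : ℕ) :
    pollaczek 1 0 x (j + 2) =
      2 * x * pollaczek 1 0 x (j + 1) - pollaczek 1 0 x j + pollaczek 1 0 x j / (j + 2) := by
  have : (j + 2 : ℝ) ≠ 0 := by positivity
  rw [pollaczek]
  field_simp
  ring

lemma continuous_pollaczek (j : ℕ) : Continuous fun x : ℝ => pollaczek 1 0 x j := by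
  induction j using Nat.twoStepInduction with
  | zero => simp only [pollaczek]; fun_prop
  | one => simp only [pollaczek]; fun_prop
  | more j h0 h1 =>
    simp only [pollaczek_one_zero_succ_succ]
    fun_prop

/-- A sequence whose ratios tend to `1 + δ` and which dominates the polynomials on `[-1, 1]` up to
a constant. -/
noncomputable def pollaczekMajorant (δ : ℝ) : ℕ → ℝ
  | 0 => 1
  | j + 1 => (1 + δ + 1 / (δ * (j + 2))) * pollaczekMajorant δ j

lemma pollaczekMajorant_pos {δ : ℝ} (hδ : 0 < δ) (j : ℕ) : 0 < pollaczekMajorant δ j := by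
  induction j with
  | zero => simp [pollaczekMajorant]
  | succ j ih => rw [pollaczekMajorant]; positivity

/-- With `x = cos θ`, the recurrence reads `P_{j+2} - e^{iθ} P_{j+1} =
e^{-iθ} (P_{j+1} - e^{iθ} P_j) + P_j / (j+2)`, so the quantity bounded here grows at each step by
at most the factor that defines `pollaczekMajorant`. -/
lemma pollaczek_energy_le {δ : ℝ} (hδ : 0 < δ) (θ : ℝ) (j : ℕ) :
    ‖(pollaczek 1 0 (Real.cos θ) (j + 1) : ℂ)
        - Complex.exp (θ * Complex.I) * pollaczek 1 0 (Real.cos θ) j‖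
      + δ * |pollaczek 1 0 (Real.cos θ) j| ≤ (3 + δ) * pollaczekMajorant δ j := by
  have hω : ‖Complex.exp (θ * Complex.I)‖ = 1 := Complex.norm_exp_ofReal_mul_I θ
  have hω' : ‖Complex.exp (-(θ * Complex.I))‖ = 1 := by
    rw [Complex.exp_neg, norm_inv, hω, inv_one]
  have hωω : Complex.exp (θ * Complex.I) * Complex.exp (-(θ * Complex.I)) = 1 := by
    rw [← Complex.exp_add]; simp
  have hsum : (2 : ℂ) * Real.cos θ
      = Complex.exp (θ * Complex.I) + Complex.exp (-(θ * Complex.I)) := by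
    rw [Complex.ofReal_cos, Complex.cos]; ring_nf
  induction j with
  | zero =>
    simp only [pollaczek, pollaczekMajorant]
    have h1 : ‖((((1 : ℝ) + 1) * Real.cos θ + 0 : ℝ) : ℂ) - Complex.exp (θ * Complex.I) * (1 : ℝ)‖
        ≤ 2 + 1 := by
      refine (norm_sub_le _ _).trans (add_le_add ?_ ?_)
      · rw [Complex.norm_real, Real.norm_eq_abs, add_zero, abs_mul]
        have := Real.abs_cos_le_one θ
        norm_num; linarith
      · simp [hω]
    simp only [abs_one, mul_one]
    linarith
  | succ j ih =>
    set p := pollaczek 1 0 (Real.cos θ) j with hp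
    set q := pollaczek 1 0 (Real.cos θ) (j + 1) with hq
    set ω := Complex.exp (θ * Complex.I)
    set ω' := Complex.exp (-(θ * Complex.I))
    set D := ‖(q : ℂ) - ω * p‖ with hD
    have hj : (0 : ℝ) < (j : ℝ) + 2 := by positivity
    have hrec : (pollaczek 1 0 (Real.cos θ) (j + 1 + 1) : ℂ) - ω * q
        = ω' * (q - ω * p) + (p / (j + 2) : ℝ) := by
      rw [pollaczek_one_zero_succ_succ]
      push_cast
      push_cast at hsum
      simp only [← hp, ← hq]
      linear_combination (q : ℂ) * hsum + (p : ℂ) * hωω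
    have h1 : ‖(pollaczek 1 0 (Real.cos θ) (j + 1 + 1) : ℂ) - ω * q‖ ≤ D + |p| / (j + 2) := by
      rw [hrec]
      refine (norm_add_le _ _).trans (add_le_add ?_ ?_)
      · rw [norm_mul, hω', one_mul]
      · rw [Complex.norm_real, Real.norm_eq_abs, abs_div, abs_of_pos hj]
    have h2 : |q| ≤ D + |p| := by
      have : (q : ℂ) = (q - ω * p) + ω * p := by ring
      have h := norm_add_le ((q : ℂ) - ω * p) (ω * p)
      rw [← this, norm_mul, hω, one_mul, Complex.norm_real, Complex.norm_real] at h
      exact h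
    have hD0 : 0 ≤ D := norm_nonneg _
    have key : D + |p| / (j + 2) + δ * (D + |p|)
        ≤ (1 + δ + 1 / (δ * (j + 2))) * (D + δ * |p|) := by
      have e : (1 + δ + 1 / (δ * (j + 2))) * (D + δ * |p|)
          = D + |p| / (j + 2) + δ * (D + |p|) + (D / (δ * (j + 2)) + δ * δ * |p|) := by
        field_simp; ring
      rw [e]
      have : 0 ≤ D / (δ * (j + 2)) + δ * δ * |p| := by positivity
      linarith
    calc _ ≤ D + |p| / (j + 2) + δ * (D + |p|) := by gcongr
      _ ≤ _ := key
      _ ≤ (1 + δ + 1 / (δ * (j + 2))) * ((3 + δ) * pollaczekMajorant δ j) := by gcongr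
      _ = _ := by rw [pollaczekMajorant]; ring

/-- The polynomials grow subexponentially, uniformly on `[-1, 1]`. -/
lemma exists_pollaczek_bound {R : ℝ} (hR0 : 0 < R) (hR : R < 1) :
    ∃ B : ℕ → ℝ, (∀ j x, x ∈ Icc (-1 : ℝ) 1 → |pollaczek 1 0 x j| ≤ B j) ∧
      Summable fun j : ℕ => (j + 1) * B j * R ^ j := by
  -- then `(1 + δ) R = 1 - (1 - R)² < 1`
  set δ := 1 - R with hδ'
  have hδ : 0 < δ := by linarith
  refine ⟨fun j => (3 + δ) / δ * pollaczekMajorant δ j, fun j x hx => ?_, ?_⟩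
  · have h := pollaczek_energy_le hδ (Real.arccos x) j
    rw [Real.cos_arccos hx.1 hx.2] at h
    beta_reduce
    rw [div_mul_eq_mul_div, le_div_iff₀ hδ, mul_comm]
    refine le_trans ?_ h
    exact le_add_of_nonneg_left (norm_nonneg _)
  · have hr : (1 + δ) * R < 1 := by nlinarith
    refine summable_of_ratio_test_tendsto_lt_one hr (.of_forall fun j => ?_) ?_
    · have := pollaczekMajorant_pos hδ j
      positivity
    · have h1 : Filter.Tendsto (fun j : ℕ => (1 + 1 / ((j : ℝ) + 1))
          * (1 + δ + 1 / δ * ((1 / ((j : ℝ) + 1)) / (1 + 1 / ((j : ℝ) + 1)))) * R)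
          Filter.atTop (nhds ((1 + 0) * (1 + δ + 1 / δ * (0 / (1 + 0))) * R)) := by
        have h0 := tendsto_one_div_add_atTop_nhds_zero_nat (𝕜 := ℝ)
        refine Filter.Tendsto.mul_const _ ((h0.const_add 1).mul (Filter.Tendsto.const_add _
          (Filter.Tendsto.const_mul _ (h0.div (h0.const_add 1) (by norm_num)))))
      have e : (1 + 0) * (1 + δ + 1 / δ * (0 / (1 + 0))) * R = (1 + δ) * R := by ring
      rw [e] at h1
      refine h1.congr fun j => ?_
      have hM := pollaczekMajorant_pos hδ j
      have hM' := pollaczekMajorant_pos hδ (j + 1)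
      rw [Real.norm_of_nonneg (by positivity), Real.norm_of_nonneg (by positivity)]
      beta_reduce
      rw [show pollaczekMajorant δ (j + 1)
          = (1 + δ + 1 / (δ * (j + 2))) * pollaczekMajorant δ j from rfl]
      push_cast
      field_simp
      ring

lemma summable_pollaczek_mul_pow {z : ℝ} (hz : |z| < 1) {x : ℝ} (hx : x ∈ Icc (-1 : ℝ) 1) :
    Summable fun j : ℕ => pollaczek 1 0 x j * z ^ j := by
  obtain ⟨R, h1, h2⟩ := exists_between hz
  obtain ⟨B, hB, hs⟩ := exists_pollaczek_bound ((abs_nonneg z).trans_lt h1) h2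
  refine Summable.of_norm_bounded hs fun j => ?_
  have hB0 : 0 ≤ B j := (abs_nonneg _).trans (hB j x hx)
  rw [norm_mul, norm_pow, Real.norm_eq_abs, Real.norm_eq_abs]
  calc _ ≤ B j * R ^ j := by gcongr; exact hB j x hx
    _ ≤ _ := by
      have : 0 ≤ B j * R ^ j := mul_nonneg hB0 (pow_nonneg ((abs_nonneg z).trans h1.le) _)
      nlinarith [mul_nonneg (Nat.cast_nonneg (α := ℝ) j) this]

/-! ### The generating function -/

/-- The angle in `(0, π)` under which `e^{iθ}`, `0 < θ < π`, is seen from the point `z` of the real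
axis. It is written with `arctan` of its cotangent, which makes it easy to differentiate in `z`. -/
noncomputable def viewAngle (θ z : ℝ) : ℝ :=
  Real.pi / 2 - Real.arctan ((Real.cos θ - z) / Real.sin θ)

lemma viewAngle_mem (θ z : ℝ) : viewAngle θ z ∈ Ioo 0 Real.pi := by
  have h1 := Real.arctan_lt_pi_div_two ((Real.cos θ - z) / Real.sin θ)
  have h2 := Real.neg_pi_div_two_lt_arctan ((Real.cos θ - z) / Real.sin θ)
  constructor <;> simp only [viewAngle] <;> linarith

lemma sin_viewAngle_pos (θ z : ℝ) : 0 < Real.sin (viewAngle θ z) :=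
  Real.sin_pos_of_mem_Ioo (viewAngle_mem θ z)

lemma cos_viewAngle (θ z : ℝ) : Real.cos (viewAngle θ z)
    = (Real.cos θ - z) / Real.sin θ * Real.sin (viewAngle θ z) := by
  rw [viewAngle, Real.cos_pi_div_two_sub, Real.sin_pi_div_two_sub, mul_comm,
    Real.cos_arctan, Real.sin_arctan]
  ring

lemma viewAngle_zero {θ : ℝ} (hθ : θ ∈ Ioo 0 Real.pi) : viewAngle θ 0 = θ := by
  have h : (Real.cos θ - 0) / Real.sin θ = Real.tan (Real.pi / 2 - θ) := by
    rw [Real.tan_pi_div_two_sub, Real.tan_eq_sin_div_cos, inv_div, sub_zero]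
  rw [viewAngle, h, Real.arctan_tan (by linarith [hθ.2]) (by linarith [hθ.1])]
  ring

lemma one_sub_two_mul_cos_pos {θ : ℝ} (hθ : θ ∈ Ioo 0 Real.pi) (z : ℝ) :
    0 < 1 - 2 * Real.cos θ * z + z ^ 2 := by
  have := Real.sin_pos_of_mem_Ioo hθ
  nlinarith [Real.sin_sq_add_cos_sq θ, sq_nonneg (Real.cos θ - z)]

/-- The closed form of `∑ P_j(cos θ) z^j`, in terms of the angle `viewAngle θ z`. -/
noncomputable def pollaczekGen (θ z : ℝ) : ℝ :=
  Real.sin (viewAngle θ z) / Real.sin θ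
    * Real.exp ((viewAngle θ z - θ) * (Real.cos θ / Real.sin θ))

lemma hasDerivAt_pollaczekGen {θ : ℝ} (hθ : θ ∈ Ioo 0 Real.pi) (z : ℝ) :
    HasDerivAt (pollaczekGen θ)
      ((2 * Real.cos θ - z) / (1 - 2 * Real.cos θ * z + z ^ 2) * pollaczekGen θ z) z := by
  have hs := Real.sin_pos_of_mem_Ioo hθ
  have hD := one_sub_two_mul_cos_pos hθ z
  have hA : HasDerivAt (viewAngle θ) (Real.sin θ / (1 - 2 * Real.cos θ * z + z ^ 2)) z := by
    have h := ((((hasDerivAt_id z).const_sub (Real.cos θ)).div_const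
      (Real.sin θ)).arctan).const_sub (Real.pi / 2)
    refine h.congr_deriv ?_
    have h2 : 1 + ((Real.cos θ - id z) / Real.sin θ) ^ 2
        = (1 - 2 * Real.cos θ * z + z ^ 2) / Real.sin θ ^ 2 := by
      field_simp
      simp only [id]
      linear_combination Real.sin_sq_add_cos_sq θ
    rw [h2]
    field_simp
  have h := ((hA.sin).div_const (Real.sin θ)).mul
    (((hA.sub_const θ).mul_const (Real.cos θ / Real.sin θ)).exp)
  refine h.congr_deriv ?_
  rw [cos_viewAngle, pollaczekGen]
  field_simp
  ring

lemma pollaczekGen_zero {θ : ℝ} (hθ : θ ∈ Ioo 0 Real.pi) : pollaczekGen θ 0 = 1 := by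
  rw [pollaczekGen, viewAngle_zero hθ]
  simp [(Real.sin_pos_of_mem_Ioo hθ).ne']

lemma pollaczekGen_pos {θ : ℝ} (hθ : θ ∈ Ioo 0 Real.pi) (z : ℝ) : 0 < pollaczekGen θ z :=
  mul_pos (div_pos (sin_viewAngle_pos θ z) (Real.sin_pos_of_mem_Ioo hθ)) (Real.exp_pos _)

lemma hasDerivAt_tsum_pollaczek {x : ℝ} (hx : x ∈ Icc (-1 : ℝ) 1) {z : ℝ} (hz : |z| < 1) :
    HasDerivAt (fun z : ℝ => ∑' j : ℕ, pollaczek 1 0 x j * z ^ j)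
      (∑' j : ℕ, pollaczek 1 0 x j * (j * z ^ (j - 1))) z := by
  obtain ⟨R, h1, h2⟩ := exists_between hz
  have hR := (abs_nonneg z).trans_lt h1
  obtain ⟨B, hB, hs⟩ := exists_pollaczek_bound hR h2
  have hB0 : ∀ j, 0 ≤ B j := fun j => (abs_nonneg _).trans (hB j x hx)
  refine hasDerivAt_tsum_of_isPreconnected (t := Ioo (-R) R) (y₀ := 0)
    (u := fun j : ℕ => 1 / R * ((j + 1) * B j * R ^ j))
    (hs.mul_left _) isOpen_Ioo isPreconnected_Ioo
    (fun j y _ => (hasDerivAt_pow j y).const_mul _) (fun j y hy => ?_) ⟨by linarith, hR⟩ ?_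
    (abs_lt.mp h1)
  · have hy' : |y| ≤ R := (abs_lt.mpr hy).le
    rw [norm_mul, norm_mul, norm_pow, Real.norm_eq_abs, Real.norm_eq_abs y, Real.norm_natCast]
    have h3 : (j : ℝ) * |y| ^ (j - 1) ≤ 1 / R * ((j + 1) * R ^ j) := by
      rcases j with _ | j
      · simp; exact hR.le
      · have : 1 / R * ((((j + 1 : ℕ) : ℝ) + 1) * R ^ (j + 1))
            = (((j + 1 : ℕ) : ℝ) + 1) * R ^ j := by
          field_simp
          ring
        rw [this, Nat.add_sub_cancel]
        gcongr
        linarith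
    calc _ ≤ B j * (1 / R * ((j + 1) * R ^ j)) := by gcongr; exacts [hB0 j, hB j x hx]
      _ = _ := by ring
  · exact summable_pollaczek_mul_pow (by simp) hx

/-- The closed form of the generating function: both sides solve `(1 - 2xz + z²) G' = (2x - z) G`,
`G(0) = 1`. -/
lemma tsum_pollaczek_eq_pollaczekGen {θ : ℝ} (hθ : θ ∈ Ioo 0 Real.pi) {z : ℝ} (hz : |z| < 1) :
    ∑' j : ℕ, pollaczek 1 0 (Real.cos θ) j * z ^ j = pollaczekGen θ z := by
  have hx : Real.cos θ ∈ Icc (-1 : ℝ) 1 := Real.cos_mem_Icc θ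
  set x := Real.cos θ with hxdef
  set S : ℝ → ℝ := fun z => ∑' j : ℕ, pollaczek 1 0 x j * z ^ j with hS
  have hode : ∀ t ∈ Ioo (-1 : ℝ) 1,
      HasDerivAt S ((2 * x - t) / (1 - 2 * x * t + t ^ 2) * S t) t := by
    intro t ht
    have ht' : |t| < 1 := abs_lt.mpr ht
    refine (hasDerivAt_tsum_pollaczek hx ht').congr_deriv ?_
    have hD := one_sub_two_mul_cos_pos hθ t
    rw [div_mul_eq_mul_div, eq_div_iff hD.ne']
    -- summability of the differentiated series
    obtain ⟨R, h1, h2⟩ := exists_between ht'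
    have hR := (abs_nonneg t).trans_lt h1
    obtain ⟨B, hB, hs⟩ := exists_pollaczek_bound hR h2
    have hB0 : ∀ j, 0 ≤ B j := fun j => (abs_nonneg _).trans (hB j x hx)
    have hs0 : Summable fun j : ℕ => pollaczek 1 0 x j * t ^ j :=
      summable_pollaczek_mul_pow ht' hx
    have hs1 : Summable fun j : ℕ => (j : ℝ) * (pollaczek 1 0 x j * t ^ j) := by
      refine Summable.of_norm_bounded hs fun j => ?_
      rw [norm_mul, norm_mul, norm_pow, Real.norm_eq_abs t, Real.norm_natCast]
      calc _ ≤ ((j : ℝ) + 1) * (B j * R ^ j) := by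
            gcongr
            exacts [by linarith, hB0 j, hB j x hx]
        _ = _ := by ring
    have hd : Summable fun j : ℕ => pollaczek 1 0 x (j + 1) * ((j + 1) * t ^ j) := by
      by_cases h0 : t = 0
      · refine summable_of_ne_finset_zero (s := {0}) fun j hj => ?_
        simp only [Finset.mem_singleton] at hj
        simp [h0, hj]
      · refine (((summable_nat_add_iff 1).mpr hs1).mul_left (1 / t)).congr fun j => ?_
        push_cast
        field_simp
        ring
    have e1 : ∑' j : ℕ, pollaczek 1 0 x j * (j * t ^ (j - 1))
        = ∑' j : ℕ, pollaczek 1 0 x (j + 1) * ((j + 1) * t ^ j) := by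
      rw [Summable.tsum_eq_zero_add]
      · simp
      · rw [← summable_nat_add_iff 1]
        simpa using hd
    rw [e1]
    set D := ∑' j : ℕ, pollaczek 1 0 x (j + 1) * ((j + 1) * t ^ j) with hDdef
    have hDs : HasSum (fun j : ℕ => pollaczek 1 0 x (j + 1) * ((j + 1) * t ^ j)) D := hd.hasSum
    have hSs : HasSum (fun j : ℕ => pollaczek 1 0 x j * t ^ j) (S t) := hs0.hasSum
    -- `∑ j P_j t^j = t D`
    have hT : HasSum (fun j : ℕ => (j : ℝ) * (pollaczek 1 0 x j * t ^ j)) (t * D) := by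
      rw [← hasSum_nat_add_iff' 1]
      simp only [Finset.range_one, Finset.sum_singleton, Nat.cast_zero, zero_mul, sub_zero]
      refine (hDs.mul_left t).congr_fun fun j => ?_
      push_cast; ring
    -- the recurrence, multiplied by `t^j` and summed
    have hrec : HasSum (fun j : ℕ => (j + 2) * (pollaczek 1 0 x (j + 2) * t ^ (j + 1)))
        (2 * x * (t * D + S t - 1) - (t * (t * D + S t))) := by
      have ha : HasSum (fun j : ℕ => (j + 2) * (pollaczek 1 0 x (j + 1) * t ^ (j + 1)))
          (t * D + S t - 1) := by
        have := (hT.add hSs)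
        rw [← hasSum_nat_add_iff' 1] at this
        simp only [Finset.range_one, Finset.sum_singleton, Nat.cast_zero, zero_add,
          pow_zero, mul_one, pollaczek] at this
        refine this.congr_fun fun j => ?_
        push_cast; ring
      refine ((ha.mul_left (2 * x)).sub ((hT.add hSs).mul_left t)).congr_fun fun j => ?_
      rw [pollaczek_one_zero_succ_succ]
      field_simp
      ring
    have hD1 := hDs
    rw [← hasSum_nat_add_iff' 1] at hD1
    have hfin := hD1.unique (hrec.congr_fun fun j => by push_cast; ring)
    simp [pollaczek] at hfin
    linear_combination hfin
  -- hence the quotient of the two functions is constant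
  have hconst : ∀ t ∈ Ioo (-1 : ℝ) 1, HasDerivAt (fun t => S t / pollaczekGen θ t) 0 t := by
    intro t ht
    refine ((hode t ht).div (hasDerivAt_pollaczekGen hθ t)
      (pollaczekGen_pos hθ t).ne').congr_deriv ?_
    ring
  have hz' := abs_lt.mp hz
  have h := (convex_Ioo (-1 : ℝ) 1).is_const_of_fderivWithin_eq_zero (𝕜 := ℝ)
    (f := fun t => S t / pollaczekGen θ t)
    (fun t ht => (hconst t ht).differentiableAt.differentiableWithinAt)
    (fun t ht => by
      rw [fderivWithin_of_isOpen isOpen_Ioo ht]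
      ext
      simpa using (hconst t ht).deriv) (x := z) (y := 0) hz' (by norm_num)
  have hS0 : S 0 = 1 := by
    rw [hS]
    simp only
    rw [tsum_eq_single 0 (by intro j hj; simp [hj])]
    simp [pollaczek]
  simp only [hS0, pollaczekGen_zero hθ] at h
  rw [div_one, div_eq_one_iff_eq (pollaczekGen_pos hθ z).ne'] at h
  exact h

/-! ### A Fourier integral -/

lemma normSq_sinh (x y : ℝ) :
    Complex.normSq (Complex.sinh (x + y * Complex.I)) = Real.sinh x ^ 2 + Real.sin y ^ 2 := by
  have h : Complex.sinh (x + y * Complex.I)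
      = (Real.sinh x * Real.cos y : ℝ) + (Real.cosh x * Real.sin y : ℝ) * Complex.I := by
    rw [Complex.sinh_add, Complex.cosh_mul_I, Complex.sinh_mul_I]
    push_cast
    ring
  rw [h, Complex.normSq_add_mul_I]
  nlinarith [Real.cosh_sq x, Real.sin_sq_add_cos_sq y]

lemma abs_sinh_le_norm_sinh (x y : ℝ) :
    |Real.sinh x| ≤ ‖Complex.sinh (x + y * Complex.I)‖ := by
  rw [← Real.sqrt_sq_eq_abs, ← Real.sqrt_sq (norm_nonneg _), ← Complex.normSq_eq_norm_sq,
    normSq_sinh]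
  exact Real.sqrt_le_sqrt (by nlinarith [sq_nonneg (Real.sin y)])

lemma sin_mul_cosh_le_norm_sinh (x y : ℝ) :
    Real.sin y * Real.cosh x ≤ ‖Complex.sinh (x + y * Complex.I)‖ := by
  rw [← Real.sqrt_sq (norm_nonneg (Complex.sinh _)), ← Complex.normSq_eq_norm_sq, normSq_sinh]
  refine Real.le_sqrt_of_sq_le ?_
  nlinarith [Real.cosh_sq x, Real.sin_sq_le_one y, sq_nonneg (Real.sinh x),
    mul_nonneg (sub_nonneg.mpr (Real.sin_sq_le_one y)) (sq_nonneg (Real.sinh x))]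

lemma sinh_add_mul_I_ne_zero {a : ℝ} (ha : a ∈ Ioo 0 Real.pi) (r : ℝ) :
    Complex.sinh (r + a * Complex.I) ≠ 0 := by
  rw [← norm_pos_iff]
  exact (mul_pos (Real.sin_pos_of_mem_Ioo ha) (Real.cosh_pos r)).trans_le
    (sin_mul_cosh_le_norm_sinh r a)

lemma inv_cosh_le (r : ℝ) : (Real.cosh r)⁻¹ ≤ 2 * Real.exp (-|r|) := by
  rw [← Real.cosh_abs, inv_le_iff_one_le_mul₀ (Real.cosh_pos _), Real.cosh_eq]
  have h1 := Real.exp_pos (-|r|)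
  have h2 : Real.exp (-|r|) * Real.exp |r| = 1 := by rw [← Real.exp_add]; simp
  nlinarith

lemma integrable_exp_neg_abs : Integrable fun r : ℝ => Real.exp (-|r|) := by
  rw [← integrableOn_univ, ← Iic_union_Ioi (a := (0 : ℝ))]
  refine IntegrableOn.union ((integrableOn_exp_Iic 0).congr_fun (fun r hr => ?_) measurableSet_Iic)
    ((integrableOn_exp_neg_Ioi 0).congr_fun (fun r hr => ?_) measurableSet_Ioi)
  · simp [abs_of_nonpos (mem_Iic.mp hr)]
  · simp [abs_of_pos (mem_Ioi.mp hr)]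

lemma integrable_inv_cosh : Integrable fun r : ℝ => (Real.cosh r)⁻¹ := by
  refine (integrable_exp_neg_abs.const_mul 2).mono' ?_ (.of_forall fun r => ?_)
  · exact (Real.continuous_cosh.inv₀ fun r => (Real.cosh_pos r).ne').aestronglyMeasurable
  · rw [Real.norm_of_nonneg (inv_nonneg.mpr (Real.cosh_pos r).le)]
    exact inv_cosh_le r

lemma integrable_exp_div_sinh {a : ℝ} (ha : a ∈ Ioo 0 Real.pi) (u : ℝ) :
    Integrable fun r : ℝ =>
      Complex.exp (r * u * Complex.I) / Complex.sinh (r + a * Complex.I) := by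
  have hs := Real.sin_pos_of_mem_Ioo ha
  refine (integrable_inv_cosh.const_mul (Real.sin a)⁻¹).mono' ?_ (.of_forall fun r => ?_)
  · exact (Continuous.div (by fun_prop) (by fun_prop)
      fun r => sinh_add_mul_I_ne_zero ha r).aestronglyMeasurable
  · rw [norm_div]
    have : ‖Complex.exp (r * u * Complex.I)‖ = 1 := by
      rw [← Complex.ofReal_mul, Complex.norm_exp_ofReal_mul_I]
    rw [this, one_div, ← mul_inv]
    exact inv_anti₀ (mul_pos hs (Real.cosh_pos r)) (sin_mul_cosh_le_norm_sinh r a)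

/-- The reflection `r ↦ -r` replaces the integrand by minus its conjugate. It reduces integrals over
the line to integrals over the half-line. -/
lemma exp_div_sinh_neg (a u r : ℝ) :
    Complex.exp ((-r : ℝ) * u * Complex.I) / Complex.sinh ((-r : ℝ) + a * Complex.I) =
      -(starRingEnd ℂ) (Complex.exp (r * u * Complex.I) / Complex.sinh (r + a * Complex.I)) := by
  have h : ((-r : ℝ) : ℂ) + a * Complex.I = -(starRingEnd ℂ) (r + a * Complex.I) := by
    simp
    ring
  rw [h, Complex.sinh_neg, Complex.sinh_conj, map_div₀, ← Complex.exp_conj, div_neg]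
  simp

/-- The case `u = 0`: the real part is odd, and the imaginary part has the primitive
`-arctan (sinh r / sin a)`. -/
lemma integral_inv_sinh {a : ℝ} (ha : a ∈ Ioo 0 Real.pi) :
    ∫ r : ℝ, 1 / Complex.sinh (r + a * Complex.I) = -Real.pi * Complex.I := by
  have hs := Real.sin_pos_of_mem_Ioo ha
  have hint : Integrable fun r : ℝ => 1 / Complex.sinh (r + a * Complex.I) := by
    simpa using integrable_exp_div_sinh ha 0
  apply Complex.ext
  · have h1 : ∫ r : ℝ, 1 / Complex.sinh (r + a * Complex.I)
        = -(starRingEnd ℂ) (∫ r : ℝ, 1 / Complex.sinh (r + a * Complex.I)) := by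
      rw [← integral_conj, ← integral_neg, ← integral_neg_eq_self]
      refine integral_congr_ae (.of_forall fun r => ?_)
      simpa using exp_div_sinh_neg a 0 r
    have h2 := congrArg Complex.re h1
    simp only [Complex.neg_re, Complex.conj_re] at h2
    have h3 : (-(Real.pi : ℂ) * Complex.I).re = 0 := by simp
    rw [h3]
    linarith
  · have h1 : (∫ r : ℝ, 1 / Complex.sinh (r + a * Complex.I)).im
        = ∫ r : ℝ, (1 / Complex.sinh (r + a * Complex.I)).im :=
      (Complex.imCLM.integral_comp_comm hint).symm
    have h2 : ∀ r : ℝ, (1 / Complex.sinh (r + a * Complex.I)).im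
        = -(Real.sin a * Real.cosh r / (Real.sinh r ^ 2 + Real.sin a ^ 2)) := by
      intro r
      rw [one_div, Complex.inv_im, normSq_sinh, Complex.sinh_add, Complex.cosh_mul_I,
        Complex.sinh_mul_I, ← Complex.ofReal_sinh, ← Complex.ofReal_cosh, ← Complex.ofReal_sin,
        ← Complex.ofReal_cos]
      simp [-Complex.ofReal_sin, -Complex.ofReal_cos]
      ring
    have h3 : ∀ r : ℝ, HasDerivAt (fun r => -Real.arctan (Real.sinh r / Real.sin a))
        (-(Real.sin a * Real.cosh r / (Real.sinh r ^ 2 + Real.sin a ^ 2))) r := by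
      intro r
      refine (((Real.hasDerivAt_sinh r).div_const (Real.sin a)).arctan.neg).congr_deriv ?_
      have : Real.sinh r ^ 2 + Real.sin a ^ 2 ≠ 0 := by positivity
      field_simp
      ring
    have hi : Integrable fun r : ℝ =>
        -(Real.sin a * Real.cosh r / (Real.sinh r ^ 2 + Real.sin a ^ 2)) := by
      simp only [← h2]
      exact Complex.imCLM.integrable_comp hint
    have htop : Filter.Tendsto Real.sinh Filter.atTop Filter.atTop :=
      Real.sinhOrderIso.tendsto_atTop
    have hbot : Filter.Tendsto Real.sinh Filter.atBot Filter.atBot :=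
      Real.sinhOrderIso.tendsto_atBot
    have h4 := integral_of_hasDerivAt_of_tendsto h3 hi
      (((tendsto_nhds_of_tendsto_nhdsWithin Real.tendsto_arctan_atBot).comp
        (hbot.atBot_div_const hs)).neg)
      (((tendsto_nhds_of_tendsto_nhdsWithin Real.tendsto_arctan_atTop).comp
        (htop.atTop_div_const hs)).neg)
    rw [h1]
    simp only [h2]
    rw [h4]
    simp
    ring

/-- The quotient `(e^{izu} - e^{-πu}) / sinh z`, continued to the zero `iπ` of `sinh`. -/
noncomputable def stripQuotient (u : ℝ) (z : ℂ) : ℂ :=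
  dslope (fun z => Complex.exp (z * u * Complex.I)) (Real.pi * Complex.I) z /
    dslope Complex.sinh (Real.pi * Complex.I) z

lemma sinh_pi_mul_I : Complex.sinh (Real.pi * Complex.I) = 0 := by
  rw [Complex.sinh_mul_I, Complex.sin_pi, zero_mul]

lemma stripQuotient_of_ne (u : ℝ) {z : ℂ} (hz : z ≠ Real.pi * Complex.I) :
    stripQuotient u z
      = (Complex.exp (z * u * Complex.I) - Real.exp (-(Real.pi * u))) / Complex.sinh z := by
  have h : Complex.exp (Real.pi * Complex.I * u * Complex.I) = Real.exp (-(Real.pi * u)) := by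
    rw [Complex.ofReal_exp]
    congr 1
    push_cast
    linear_combination (Real.pi : ℂ) * u * Complex.I_sq
  have hz' : z - Real.pi * Complex.I ≠ 0 := sub_ne_zero.mpr hz
  rw [stripQuotient, dslope_of_ne _ hz, dslope_of_ne _ hz, slope_def_field, slope_def_field,
    sinh_pi_mul_I, h, sub_zero, div_div_div_cancel_right₀ hz']

lemma differentiableAt_stripQuotient (u : ℝ) {z : ℂ} (hz0 : 0 < z.im) (hz : z.im < 2 * Real.pi) :
    DifferentiableAt ℂ (stripQuotient u) z := by
  have hd : ∀ f : ℂ → ℂ, Differentiable ℂ f →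
      DifferentiableAt ℂ (dslope f (Real.pi * Complex.I)) z := fun f hf =>
    ((Complex.differentiableOn_dslope Filter.univ_mem).mpr hf.differentiableOn).differentiableAt
      Filter.univ_mem
  refine (hd _ (by fun_prop)).div (hd _ Complex.differentiable_sinh) ?_
  by_cases h : z = Real.pi * Complex.I
  · rw [h, dslope_same, Complex.deriv_sinh, Complex.cosh_mul_I, Complex.cos_pi]
    norm_num
  · rw [dslope_of_ne _ h, slope_def_field, sinh_pi_mul_I, sub_zero]
    refine div_ne_zero (fun h0 => h ?_) (sub_ne_zero.mpr h)
    have h1 := normSq_sinh z.re z.im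
    rw [Complex.re_add_im, h0, map_zero] at h1
    have h2 : Real.sinh z.re = 0 := by
      nlinarith [sq_nonneg (Real.sinh z.re), sq_nonneg (Real.sin z.im)]
    have h3 : Real.sin (z.im - Real.pi) = 0 := by
      rw [Real.sin_sub_pi, neg_eq_zero]
      nlinarith [sq_nonneg (Real.sinh z.re), sq_nonneg (Real.sin z.im)]
    rw [Real.sin_eq_zero_iff_of_lt_of_lt (by linarith) (by linarith)] at h3
    apply Complex.ext
    · simpa using h2
    · simp; linarith

lemma norm_stripQuotient_le (u : ℝ) {x y : ℝ} (hx : x ≠ 0) (hy0 : 0 ≤ y) (hy : y ≤ 2 * Real.pi) :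
    ‖stripQuotient u (x + y * Complex.I)‖ ≤ 2 * Real.exp (2 * Real.pi * |u|) / |Real.sinh x| := by
  rw [stripQuotient_of_ne u (fun h => hx (by simpa using congrArg Complex.re h)), norm_div]
  have hpos : 0 < |Real.sinh x| := abs_pos.mpr (by simpa using hx)
  refine div_le_div₀ (by positivity) ?_ hpos (abs_sinh_le_norm_sinh x y)
  have hb : ∀ t : ℝ, 0 ≤ t → t ≤ 2 * Real.pi → -(t * u) ≤ 2 * Real.pi * |u| := fun t h1 h2 => by
    have := neg_abs_le u
    nlinarith [abs_nonneg u]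
  refine (norm_sub_le _ _).trans ?_
  rw [two_mul (Real.exp _)]
  refine add_le_add ?_ ?_
  · rw [Complex.norm_exp]
    refine Real.exp_le_exp.mpr (le_trans (le_of_eq ?_) (hb y hy0 hy))
    simp
  · rw [Complex.norm_real, Real.norm_of_nonneg (Real.exp_pos _).le]
    exact Real.exp_le_exp.mpr (hb Real.pi Real.pi_pos.le (by linarith [Real.pi_pos]))

/-- Integration of `(e^{izu} - e^{-πu}) / sinh z` over the boundary of the strip
`a ≤ Im z ≤ a + π`, in which the only zero `iπ` of `sinh` is cancelled by the numerator. -/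
lemma integral_exp_div_sinh {a : ℝ} (ha : a ∈ Ioo 0 Real.pi) (u : ℝ) :
    ∫ r : ℝ, Complex.exp (r * u * Complex.I) / Complex.sinh (r + a * Complex.I) =
      -2 * Real.pi * Complex.I * (Real.exp (a * u) / (1 + Real.exp (Real.pi * u)) : ℝ) := by
  have hpi := Real.pi_pos
  have him : ∀ (x y : ℝ), ((x : ℂ) + y * Complex.I).im = y := fun x y => by simp
  -- the difference `K` of the values on the two edges of the strip is a combination of the
  -- integrand for `u` and of the integrand for `u = 0`
  set α : ℝ := (1 + Real.exp (-(Real.pi * u))) * Real.exp (-(a * u)) with hα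
  set β : ℝ := Real.exp (-(Real.pi * u)) with hβ
  set K : ℝ → ℂ := fun r => α * (Complex.exp (r * u * Complex.I) / Complex.sinh (r + a * Complex.I))
    - 2 * β * (1 / Complex.sinh (r + a * Complex.I)) with hK
  have hK1 : ∀ r : ℝ, stripQuotient u (r + a * Complex.I)
      - stripQuotient u (r + (a + Real.pi : ℝ) * Complex.I) = K r := by
    intro r
    have hne : Complex.sinh (r + a * Complex.I) ≠ 0 := sinh_add_mul_I_ne_zero ha r
    rw [stripQuotient_of_ne, stripQuotient_of_ne]
    · have h1 : Complex.sinh (r + (a + Real.pi : ℝ) * Complex.I)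
          = -Complex.sinh (r + a * Complex.I) := by
        have : (r : ℂ) + (a + Real.pi : ℝ) * Complex.I
            = (r + a * Complex.I) + Real.pi * Complex.I := by push_cast; ring
        rw [this, Complex.sinh_add, sinh_pi_mul_I, Complex.cosh_mul_I, Complex.cos_pi]
        ring
      have h2 : Complex.exp ((r + (a + Real.pi : ℝ) * Complex.I) * u * Complex.I)
          = β * Real.exp (-(a * u)) * Complex.exp (r * u * Complex.I) := by
        rw [hβ, Complex.ofReal_exp, Complex.ofReal_exp, ← Complex.exp_add, ← Complex.exp_add]
        congr 1
        push_cast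
        linear_combination ((a : ℂ) + Real.pi) * u * Complex.I_sq
      have h3 : Complex.exp ((r + a * Complex.I) * u * Complex.I)
          = Real.exp (-(a * u)) * Complex.exp (r * u * Complex.I) := by
        rw [Complex.ofReal_exp, ← Complex.exp_add]
        congr 1
        push_cast
        linear_combination (a : ℂ) * u * Complex.I_sq
      rw [h1, h2, h3, hK, hα]
      simp only [← hβ]
      push_cast
      field_simp
      ring
    · intro h
      have := congrArg Complex.im h
      rw [him] at this
      simp at this
      linarith [ha.1]
    · intro h
      have := congrArg Complex.im h
      rw [him] at this
      simp at this
      linarith [ha.2]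
  have hKint : Integrable K := by
    refine ((integrable_exp_div_sinh ha u).const_mul _).sub (Integrable.const_mul ?_ _)
    simpa using integrable_exp_div_sinh ha 0
  have hcont : ∀ y ∈ Icc a (a + Real.pi),
      Continuous fun x : ℝ => stripQuotient u (x + y * Complex.I) := by
    intro y hy
    rw [continuous_iff_continuousAt]
    intro x
    have h := (differentiableAt_stripQuotient u (z := x + y * Complex.I)
      (by rw [him]; linarith [hy.1, ha.1]) (by rw [him]; linarith [hy.2, ha.2])).continuousAt
    exact ContinuousAt.comp (f := fun x : ℝ => (x : ℂ) + y * Complex.I) h (by fun_prop)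
  -- Cauchy's theorem for the rectangle of width `2R`
  have hrect : ∀ R : ℝ, 0 < R → ∫ x in (-R)..R, K x =
      Complex.I * (∫ y in a..(a + Real.pi), stripQuotient u ((-R : ℝ) + y * Complex.I))
      - Complex.I * (∫ y in a..(a + Real.pi), stripQuotient u (R + y * Complex.I)) := by
    intro R hR
    have h := Complex.integral_boundary_rect_eq_zero_of_differentiableOn (stripQuotient u)
      ((-R : ℝ) + a * Complex.I) (R + (a + Real.pi : ℝ) * Complex.I) (fun z hz => by
        refine (differentiableAt_stripQuotient u ?_ ?_).differentiableWithinAt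
        all_goals
          have h2 := hz.2
          rw [mem_preimage, him, him, uIcc_of_le (by linarith)] at h2
          linarith [h2.1, h2.2, ha.1, ha.2])
    have hre : ∀ (x y : ℝ), ((x : ℂ) + y * Complex.I).re = x := fun x y => by simp
    simp only [him, hre, smul_eq_mul] at h
    rw [← intervalIntegral.integral_sub] at h
    · simp only [hK1] at h
      linear_combination h
    · exact (hcont a ⟨le_rfl, by linarith⟩).intervalIntegrable _ _
    · exact (hcont (a + Real.pi) ⟨by linarith, le_rfl⟩).intervalIntegrable _ _
  have hside : ∀ R : ℝ, R ≠ 0 →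
      ‖∫ y in a..(a + Real.pi), stripQuotient u (R + y * Complex.I)‖
        ≤ 2 * Real.exp (2 * Real.pi * |u|) / |Real.sinh R| * Real.pi := by
    intro R hR
    have h := intervalIntegral.norm_integral_le_of_norm_le_const (a := a) (b := a + Real.pi)
      (C := 2 * Real.exp (2 * Real.pi * |u|) / |Real.sinh R|)
      (f := fun y : ℝ => stripQuotient u (R + y * Complex.I)) (fun y hy => by
        rw [uIoc_of_le (by linarith)] at hy
        exact norm_stripQuotient_le u hR (by linarith [hy.1, ha.1]) (by linarith [hy.2, ha.2]))
    rwa [add_sub_cancel_left, abs_of_pos hpi] at h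
  have htop : Filter.Tendsto Real.sinh Filter.atTop Filter.atTop :=
    Real.sinhOrderIso.tendsto_atTop
  have hlim0 : Filter.Tendsto (fun R : ℝ => ∫ x in (-R)..R, K x) Filter.atTop (nhds 0) := by
    have hb : Filter.Tendsto (fun R : ℝ => 4 * Real.exp (2 * Real.pi * |u|) * Real.pi
        / Real.sinh R) Filter.atTop (nhds 0) := htop.const_div_atTop _
    refine squeeze_zero_norm' ?_ hb
    filter_upwards [Filter.eventually_gt_atTop 0] with R hR
    rw [hrect R hR]
    refine (norm_sub_le _ _).trans ?_
    rw [norm_mul, norm_mul, Complex.norm_I, one_mul, one_mul]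
    have h1 := hside R hR.ne'
    have h2 := hside (-R) (neg_ne_zero.mpr hR.ne')
    rw [Real.sinh_neg, abs_neg] at h2
    rw [abs_of_pos (Real.sinh_pos_iff.mpr hR)] at h1 h2
    refine (add_le_add h2 h1).trans (le_of_eq ?_)
    ring
  have hzero : ∫ x, K x = 0 :=
    tendsto_nhds_unique (intervalIntegral_tendsto_integral hKint Filter.tendsto_neg_atTop_atBot
      Filter.tendsto_id) hlim0
  have hint0 : Integrable fun r : ℝ => 1 / Complex.sinh (r + a * Complex.I) := by
    simpa using integrable_exp_div_sinh ha 0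
  rw [hK, integral_sub ((integrable_exp_div_sinh ha u).const_mul _) (hint0.const_mul _),
    integral_const_mul, integral_const_mul, integral_inv_sinh ha] at hzero
  have hα0 : (α : ℂ) ≠ 0 := by
    rw [Complex.ofReal_ne_zero, hα]
    positivity
  have hval : Real.exp (a * u) / (1 + Real.exp (Real.pi * u)) = β / α := by
    rw [hα, hβ, Real.exp_neg, Real.exp_neg]
    have := Real.exp_pos (a * u)
    have := Real.exp_pos (Real.pi * u)
    field_simp
    ring
  rw [hval]
  generalize (∫ r : ℝ, Complex.exp (r * u * Complex.I) / Complex.sinh (r + a * Complex.I)) = J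
    at hzero ⊢
  push_cast
  field_simp
  linear_combination hzero

/-- The half-line form of `integral_exp_div_sinh`: a representation of the function that becomes
the weight at `u = cot a`. -/
lemma exp_div_one_add_exp_eq_integral {a : ℝ} (ha : a ∈ Ioo 0 Real.pi) (u : ℝ) :
    Real.exp (a * u) / (1 + Real.exp (Real.pi * u)) = 1 / Real.pi * ∫ r in Ioi (0 : ℝ),
      (Complex.I * (Complex.exp (r * u * Complex.I) / Complex.sinh (r + a * Complex.I))).re := by
  have hint := integrable_exp_div_sinh ha u
  set G : ℝ → ℂ := fun r => Complex.exp (r * u * Complex.I) / Complex.sinh (r + a * Complex.I)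
    with hG
  have h1 : ∫ r, G r = (∫ r in Ioi (0 : ℝ), G (-r)) + ∫ r in Ioi (0 : ℝ), G r := by
    rw [integral_comp_neg_Ioi, neg_zero]
    exact (intervalIntegral.integral_Iic_add_Ioi hint.integrableOn hint.integrableOn).symm
  have h2 : ∫ r in Ioi (0 : ℝ), G (-r) = -(starRingEnd ℂ) (∫ r in Ioi (0 : ℝ), G r) := by
    rw [← integral_conj, ← integral_neg]
    exact integral_congr_ae (.of_forall fun r => exp_div_sinh_neg a u r)
  have h3 : ∫ r in Ioi (0 : ℝ), (Complex.I * G r).re = -(∫ r in Ioi (0 : ℝ), G r).im := by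
    have := Complex.imCLM.integral_comp_comm (hint.integrableOn (s := Ioi 0))
    simp only [Complex.imCLM_apply] at this
    rw [← this, ← integral_neg]
    simp
  have h4 := integral_exp_div_sinh ha u
  rw [h3]
  rw [h1, h2] at h4
  have h5 := congrArg Complex.im h4
  have hpi := Real.pi_pos
  have h6 : (-2 * Real.pi * Complex.I
      * (Real.exp (a * u) / (1 + Real.exp (Real.pi * u)) : ℝ) : ℂ).im
      = -2 * Real.pi * (Real.exp (a * u) / (1 + Real.exp (Real.pi * u))) := by
    rw [Complex.im_mul_ofReal]
    simp
  rw [h6] at h5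
  simp only [Complex.add_im, Complex.neg_im, Complex.conj_im] at h5
  rw [one_div, eq_inv_mul_iff_mul_eq₀ hpi.ne']
  linarith

/-! ### The mean value property on the unit circle -/

/-- The analytic function on the unit disc whose boundary values have real part `circleKernel`.
At the singular boundary points `±1`, division by zero gives it the value `0`, which is its limit
there from within the disc. -/
noncomputable def discFunction (r z : ℝ) (ζ : ℂ) : ℂ :=
  (1 - ζ ^ 2) * Complex.exp (-r * ((1 + ζ ^ 2) / (1 - ζ ^ 2))) /
    (Complex.exp r - 2 * z * Complex.sinh r * ζ - Complex.exp (-r) * ζ ^ 2)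

lemma discFunction_denom_ne_zero {r z : ℝ} (hr : 0 < r) (hz : |z| < 1) {ζ : ℂ} (hζ : ‖ζ‖ ≤ 1) :
    Complex.exp r - 2 * z * Complex.sinh r * ζ - Complex.exp (-r) * ζ ^ 2 ≠ 0 := by
  intro h
  have h1 : Complex.exp r * (1 - z * ζ) = Complex.exp (-r) * (ζ * (ζ - z)) := by
    rw [Complex.sinh] at h
    linear_combination h
  have h2 := congrArg norm h1
  rw [norm_mul, norm_mul, norm_mul, ← Complex.ofReal_neg, ← Complex.ofReal_exp,
    ← Complex.ofReal_exp, Complex.norm_real, Complex.norm_real,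
    Real.norm_of_nonneg (Real.exp_pos _).le, Real.norm_of_nonneg (Real.exp_pos _).le] at h2
  have hzz : z ^ 2 ≤ 1 := by
    have := (sq_lt_one_iff_abs_lt_one z).mpr hz
    linarith
  have hn : Complex.normSq ζ ≤ 1 := by
    rw [Complex.normSq_eq_norm_sq]
    exact pow_le_one₀ (norm_nonneg _) hζ
  -- the Blaschke inequality
  have h3 : ‖ζ - z‖ ≤ ‖1 - z * ζ‖ := by
    refine le_of_sq_le_sq ?_ (norm_nonneg _)
    rw [← Complex.normSq_eq_norm_sq, ← Complex.normSq_eq_norm_sq]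
    rw [Complex.normSq_apply] at hn ⊢
    rw [Complex.normSq_apply]
    simp
    nlinarith [mul_nonneg (sub_nonneg.mpr hzz) (sub_nonneg.mpr hn)]
  have h4 : 0 < ‖1 - z * ζ‖ := by
    rw [norm_pos_iff]
    intro h0
    have : ‖(z : ℂ) * ζ‖ < 1 := by
      rw [norm_mul, Complex.norm_real, Real.norm_eq_abs]
      nlinarith [norm_nonneg ζ, abs_nonneg z]
    rw [← sub_eq_zero.mp h0] at this
    simp at this
  have h5 : Real.exp (-r) < Real.exp r := Real.exp_lt_exp.mpr (by linarith)
  have h6 : ‖ζ‖ * ‖ζ - z‖ ≤ ‖1 - z * ζ‖ := by nlinarith [norm_nonneg ζ, norm_nonneg (ζ - z)]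
  nlinarith [Real.exp_pos (-r)]

/-- The function `(1 + ζ²) / (1 - ζ²)` maps the disc to the right half-plane. -/
lemma norm_exp_cayley_le_one {r : ℝ} (hr : 0 < r) {ζ : ℂ} (hζ : ‖ζ‖ ≤ 1) :
    ‖Complex.exp (-r * ((1 + ζ ^ 2) / (1 - ζ ^ 2)))‖ ≤ 1 := by
  rw [Complex.norm_exp, Real.exp_le_one_iff]
  have h1 : 0 ≤ ((1 + ζ ^ 2) / (1 - ζ ^ 2)).re := by
    rw [Complex.div_re, ← add_div]
    refine div_nonneg ?_ (Complex.normSq_nonneg _)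
    have h2 : Complex.normSq (ζ ^ 2) ≤ 1 := by
      rw [Complex.normSq_eq_norm_sq, norm_pow]
      exact pow_le_one₀ (by positivity) (pow_le_one₀ (norm_nonneg _) hζ)
    rw [Complex.normSq_apply] at h2
    simp only [Complex.add_re, Complex.sub_re, Complex.add_im, Complex.sub_im, Complex.one_re,
      Complex.one_im]
    nlinarith
  have h3 : ((-r : ℂ) * ((1 + ζ ^ 2) / (1 - ζ ^ 2))).re
      = -(r * ((1 + ζ ^ 2) / (1 - ζ ^ 2)).re) := by
    rw [← Complex.ofReal_neg, Complex.re_ofReal_mul]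
    ring
  rw [h3]
  have := mul_nonneg hr.le h1
  linarith

/-- The mean value property; the value `e^{-2r}` at the centre does not depend on `z`. -/
lemma circleAverage_discFunction {r z : ℝ} (hr : 0 < r) (hz : |z| < 1) :
    Real.circleAverage (discFunction r z) 0 1 = Real.exp (-(2 * r)) := by
  have hdiff : ∀ ζ : ℂ, ‖ζ‖ ≤ 1 → 1 - ζ ^ 2 ≠ 0 → DifferentiableAt ℂ (discFunction r z) ζ := by
    intro ζ hζ h0
    have := discFunction_denom_ne_zero hr hz hζ
    unfold discFunction
    fun_prop (disch := assumption)
  have hcont : ContinuousOn (discFunction r z) (Metric.closedBall 0 1) := by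
    intro ζ hζ
    rw [mem_closedBall_zero_iff] at hζ
    by_cases h0 : 1 - ζ ^ 2 = 0
    · -- the exponential is bounded on the disc and is multiplied by `1 - ζ²`
      refine ContinuousWithinAt.div ?_ (by fun_prop) (discFunction_denom_ne_zero hr hz hζ)
      rw [ContinuousWithinAt, h0, zero_mul]
      have hlim : Filter.Tendsto (fun ζ : ℂ => ‖1 - ζ ^ 2‖)
          (nhdsWithin ζ (Metric.closedBall 0 1)) (nhds 0) := by
        have : Continuous fun ζ : ℂ => ‖1 - ζ ^ 2‖ := by fun_prop
        have h := this.continuousWithinAt (s := Metric.closedBall 0 1) (x := ζ)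
        rw [ContinuousWithinAt, h0, norm_zero] at h
        exact h
      refine squeeze_zero_norm' ?_ hlim
      filter_upwards [self_mem_nhdsWithin] with ξ hξ
      rw [mem_closedBall_zero_iff] at hξ
      rw [norm_mul]
      exact mul_le_of_le_one_right (norm_nonneg _) (norm_exp_cayley_le_one hr hξ)
    · exact (hdiff ζ hζ h0).continuousAt.continuousWithinAt
  have h := circleAverage_of_differentiable_on_off_countable (f := discFunction r z) (c := 0)
    (R := 1) (s := ∅) countable_empty (by rwa [abs_one]) (fun ζ hζ => by
      rw [abs_one, sdiff_empty, mem_ball_zero_iff] at hζ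
      refine hdiff ζ hζ.le fun h0 => ?_
      have := congrArg norm (sub_eq_zero.mp h0)
      rw [norm_one, norm_pow] at this
      have := pow_lt_one₀ (norm_nonneg ζ) hζ two_ne_zero
      linarith)
  rw [h, discFunction]
  simp
  rw [← Complex.exp_sub]
  ring_nf

/-- The product of `sin a` and the integrand of `exp_div_one_add_exp_eq_integral`, where
`a = viewAngle θ z` and `u = cot θ`. -/
noncomputable def circleKernel (z θ r : ℝ) : ℝ :=
  (Complex.I * Complex.exp (r * (Real.cos θ / Real.sin θ : ℝ) * Complex.I) * Real.sin θ /
    (((Real.cos θ - z) * Real.sinh r : ℝ) + (Real.sin θ * Real.cosh r : ℝ) * Complex.I)).re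

lemma abs_circleKernel_le (z θ r : ℝ) : |circleKernel z θ r| ≤ (Real.cosh r)⁻¹ := by
  refine (Complex.abs_re_le_norm _).trans ?_
  have h1 : ‖Complex.exp (r * (Real.cos θ / Real.sin θ : ℝ) * Complex.I)‖ = 1 := by
    rw [← Complex.ofReal_mul, Complex.norm_exp_ofReal_mul_I]
  rw [norm_div, norm_mul, norm_mul, h1, Complex.norm_I, one_mul, one_mul, Complex.norm_real,
    Real.norm_eq_abs]
  have hc := Real.cosh_pos r
  by_cases hs : Real.sin θ = 0
  · rw [hs]; simp; exact hc.le
  · have h2 := Complex.abs_im_le_norm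
      ((((Real.cos θ - z) * Real.sinh r : ℝ) : ℂ) + (Real.sin θ * Real.cosh r : ℝ) * Complex.I)
    have h3 : ((((Real.cos θ - z) * Real.sinh r : ℝ) : ℂ)
        + (Real.sin θ * Real.cosh r : ℝ) * Complex.I).im = Real.sin θ * Real.cosh r := by
      rw [Complex.add_im, Complex.ofReal_im, Complex.im_ofReal_mul]; simp
    rw [h3, abs_mul, abs_of_pos hc] at h2
    have h4 : 0 < |Real.sin θ| := abs_pos.mpr hs
    rw [div_le_iff₀ ((mul_pos h4 hc).trans_le h2), inv_mul_eq_div, le_div_iff₀ hc]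
    exact h2

lemma measurable_circleKernel (z : ℝ) : Measurable fun p : ℝ × ℝ => circleKernel z p.1 p.2 := by
  unfold circleKernel
  refine Complex.measurable_re.comp ?_
  fun_prop

/-- Complex conjugation symmetry, by which the integral over `(0, π)` is half of the integral over
the circle. -/
lemma circleKernel_two_pi_sub (z θ r : ℝ) :
    circleKernel z (2 * Real.pi - θ) r = circleKernel z θ r := by
  have hc : Real.cos (2 * Real.pi - θ) = Real.cos θ := Real.cos_two_pi_sub θ
  have hs : Real.sin (2 * Real.pi - θ) = -Real.sin θ := Real.sin_two_pi_sub θ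
  rw [circleKernel, circleKernel, hc, hs, ← Complex.conj_re]
  congr 1
  simp only [map_div₀, map_mul, map_add, Complex.conj_I, Complex.conj_ofReal, ← Complex.exp_conj]
  push_cast
  ring_nf

lemma re_discFunction_circleMap {r : ℝ} (z θ : ℝ) :
    (discFunction r z (circleMap 0 1 θ)).re = circleKernel z θ r := by
  rw [← circleKernel_two_pi_sub, circleKernel, Real.cos_two_pi_sub, Real.sin_two_pi_sub]
  congr 1
  have hζ : circleMap 0 1 θ = Real.cos θ + Real.sin θ * Complex.I := by
    rw [circleMap_zero, Complex.exp_mul_I]; simp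
  have hsc : (Real.sin θ : ℂ) ^ 2 + (Real.cos θ : ℂ) ^ 2 = 1 := by
    exact_mod_cast Real.sin_sq_add_cos_sq θ
  have hζ0 : circleMap 0 1 θ ≠ 0 := circleMap_ne_center one_ne_zero
  have hI := Complex.I_sq
  have h1 : 1 - circleMap 0 1 θ ^ 2 = -2 * Complex.I * Real.sin θ * circleMap 0 1 θ := by
    rw [hζ]; linear_combination -hsc + (Real.sin θ : ℂ) ^ 2 * hI
  have h2 : 1 + circleMap 0 1 θ ^ 2 = 2 * Real.cos θ * circleMap 0 1 θ := by
    rw [hζ]; linear_combination -hsc + (Real.sin θ : ℂ) ^ 2 * hI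
  have h3 : Complex.exp r - 2 * z * Complex.sinh r * circleMap 0 1 θ
        - Complex.exp (-r) * circleMap 0 1 θ ^ 2
      = 2 * (((Real.cos θ - z) * Real.sinh r : ℝ) + (-Real.sin θ * Real.cosh r : ℝ) * Complex.I)
        * circleMap 0 1 θ := by
    have e1 : Complex.exp r = Real.cosh r + Real.sinh r := by
      rw [Complex.ofReal_cosh, Complex.ofReal_sinh, Complex.cosh_add_sinh]
    have e2 : Complex.exp (-r) = Real.cosh r - Real.sinh r := by
      rw [Complex.ofReal_cosh, Complex.ofReal_sinh, Complex.cosh_sub_sinh]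
    rw [e1, e2, ← Complex.ofReal_sinh]
    push_cast at h1 h2 ⊢
    linear_combination Complex.cosh r * h1 + Complex.sinh r * h2
  rw [discFunction, h1, h2, h3]
  have e3 : (-r : ℂ) * (2 * Real.cos θ * circleMap 0 1 θ
        / (-2 * Complex.I * Real.sin θ * circleMap 0 1 θ))
      = r * ((Real.cos θ / -Real.sin θ : ℝ) : ℂ) * Complex.I := by
    rw [mul_div_mul_right _ _ hζ0]
    push_cast
    by_cases hs : Complex.sin (θ : ℂ) = 0
    · simp [hs]
    · field_simp
      linear_combination (r * Complex.cos θ : ℂ) * hI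
  rw [e3]
  generalize Complex.exp (r * ((Real.cos θ / -Real.sin θ : ℝ) : ℂ) * Complex.I) = e
  generalize ((((Real.cos θ - z) * Real.sinh r : ℝ) : ℂ)
    + (-Real.sin θ * Real.cosh r : ℝ) * Complex.I) = D
  generalize circleMap 0 1 θ = ζ at hζ0
  rw [mul_right_comm, mul_div_mul_right _ _ hζ0, mul_assoc (-2 : ℂ), mul_assoc (-2 : ℂ),
    neg_mul, ← mul_neg, mul_div_mul_left _ _ two_ne_zero]
  push_cast
  ring

lemma integral_circleKernel {r z : ℝ} (hr : 0 < r) (hz : |z| < 1) :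
    ∫ θ in Ioo 0 Real.pi, circleKernel z θ r = Real.pi * Real.exp (-(2 * r)) := by
  have hpi := Real.pi_pos
  have hmeas : Measurable fun θ : ℝ => circleKernel z θ r :=
    Measurable.of_uncurry_right (f := circleKernel z) (measurable_circleKernel z)
  have hii : ∀ a b : ℝ, IntervalIntegrable (fun θ => circleKernel z θ r) volume a b := by
    intro a b
    have hc : IntervalIntegrable (fun _ : ℝ => (Real.cosh r)⁻¹) volume a b :=
      intervalIntegrable_const
    refine hc.mono_fun' hmeas.aestronglyMeasurable ?_
    filter_upwards with θ using abs_circleKernel_le z θ r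
  have h := circleAverage_discFunction hr hz
  rw [Real.circleAverage_def] at h
  have hint : IntervalIntegrable (fun θ => discFunction r z (circleMap 0 1 θ)) volume 0
      (2 * Real.pi) := by
    by_contra hn
    rw [intervalIntegral.integral_undef hn, smul_zero] at h
    exact (Real.exp_pos _).ne (by exact_mod_cast h)
  have h1 : ∫ θ in 0..(2 * Real.pi), circleKernel z θ r = 2 * Real.pi * Real.exp (-(2 * r)) := by
    have h2 := congrArg Complex.re h
    rw [Complex.smul_re, Complex.ofReal_re, smul_eq_mul, inv_mul_eq_iff_eq_mul₀ (by positivity)]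
      at h2
    rw [← h2]
    have h3 := Complex.reCLM.intervalIntegral_comp_comm hint
    simp only [Complex.reCLM_apply] at h3
    rw [← h3]
    simp only [re_discFunction_circleMap]
  have h2 : ∫ θ in Real.pi..(2 * Real.pi), circleKernel z θ r
      = ∫ θ in 0..Real.pi, circleKernel z θ r := by
    have h3 := intervalIntegral.integral_comp_sub_left (a := 0) (b := Real.pi)
      (fun θ => circleKernel z θ r) (2 * Real.pi)
    simp only [circleKernel_two_pi_sub] at h3
    rw [h3]
    congr 1 <;> ring
  rw [← intervalIntegral.integral_add_adjacent_intervals (hii 0 Real.pi)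
    (hii Real.pi (2 * Real.pi)), h2] at h1
  rw [← integral_Ioc_eq_integral_Ioo, ← intervalIntegral.integral_of_le hpi.le]
  linarith

/-- With `a = viewAngle θ z`, one has `cos a = ((cos θ - z) / sin θ) sin a`, so that `sin a` cancels
from `sin a / sinh (r + ia)` and the quotient becomes rational in `e^{iθ}`. -/
lemma circleKernel_eq {θ : ℝ} (hθ : θ ∈ Ioo 0 Real.pi) (z r : ℝ) :
    circleKernel z θ r = Real.sin (viewAngle θ z) *
      (Complex.I * (Complex.exp (r * (Real.cos θ / Real.sin θ : ℝ) * Complex.I) /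
        Complex.sinh (r + viewAngle θ z * Complex.I))).re := by
  have hs := Real.sin_pos_of_mem_Ioo hθ
  have hσ := sin_viewAngle_pos θ z
  have hne := sinh_add_mul_I_ne_zero (viewAngle_mem θ z) r
  rw [circleKernel, ← Complex.re_ofReal_mul]
  congr 1
  have h1 : Complex.sinh (r + viewAngle θ z * Complex.I) * Real.sin θ
      = Real.sin (viewAngle θ z) * (((Real.cos θ - z) * Real.sinh r : ℝ)
        + (Real.sin θ * Real.cosh r : ℝ) * Complex.I) := by
    rw [Complex.sinh_add, Complex.cosh_mul_I, Complex.sinh_mul_I, ← Complex.ofReal_sinh,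
      ← Complex.ofReal_cosh, ← Complex.ofReal_sin, ← Complex.ofReal_cos, cos_viewAngle]
    have : (Real.sin θ : ℂ) ≠ 0 := by exact_mod_cast hs.ne'
    push_cast at this ⊢
    field_simp
  have h2 : (((Real.cos θ - z) * Real.sinh r : ℝ) : ℂ)
      + (Real.sin θ * Real.cosh r : ℝ) * Complex.I ≠ 0 := by
    intro h0
    rw [h0, mul_zero] at h1
    exact mul_ne_zero hne (by exact_mod_cast hs.ne') h1
  generalize Complex.exp (r * (Real.cos θ / Real.sin θ : ℝ) * Complex.I) = e
  rw [← mul_div_assoc, ← mul_div_assoc, div_eq_div_iff h2 hne]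
  linear_combination Complex.I * e * h1

/-- The integral of the generating function against the weight `e^{θ cot θ} / (1 + e^{π cot θ})`
does not depend on `z`. -/
lemma integral_pollaczekGen {z : ℝ} (hz : |z| < 1) :
    ∫ θ in Ioo 0 Real.pi, pollaczekGen θ z *
      (Real.exp (θ * (Real.cos θ / Real.sin θ))
        / (1 + Real.exp (Real.pi * (Real.cos θ / Real.sin θ))) * Real.sin θ) = 1 / 2 := by
  have hpi := Real.pi_pos
  have h1 : ∀ θ ∈ Ioo 0 Real.pi, pollaczekGen θ z *
      (Real.exp (θ * (Real.cos θ / Real.sin θ))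
        / (1 + Real.exp (Real.pi * (Real.cos θ / Real.sin θ))) * Real.sin θ)
      = 1 / Real.pi * ∫ r in Ioi (0 : ℝ), circleKernel z θ r := by
    intro θ hθ
    have hs := Real.sin_pos_of_mem_Ioo hθ
    have h := exp_div_one_add_exp_eq_integral (viewAngle_mem θ z) (Real.cos θ / Real.sin θ)
    simp only [circleKernel_eq hθ]
    rw [integral_const_mul, mul_left_comm (1 / Real.pi), ← h, pollaczekGen,
      sub_mul, Real.exp_sub]
    have := Real.exp_pos (θ * (Real.cos θ / Real.sin θ))
    field_simp
  rw [setIntegral_congr_fun measurableSet_Ioo h1, integral_const_mul, integral_integral_swap]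
  · have h2 : ∀ r ∈ Ioi (0 : ℝ), ∫ θ in Ioo 0 Real.pi, circleKernel z θ r
        = Real.pi * Real.exp (-2 * r) := fun r hr => by
      rw [integral_circleKernel hr hz]; ring_nf
    rw [setIntegral_congr_fun measurableSet_Ioi h2, integral_const_mul,
      integral_exp_mul_Ioi (by norm_num)]
    field_simp
    norm_num
  · have hb : Integrable (fun p : ℝ × ℝ => (Real.cosh p.2)⁻¹)
        ((volume.restrict (Ioo 0 Real.pi)).prod (volume.restrict (Ioi 0))) :=
      (integrable_inv_cosh.integrableOn (s := Ioi 0)).comp_snd _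
    refine hb.mono' (measurable_circleKernel z).aestronglyMeasurable (.of_forall fun p => ?_)
    exact abs_circleKernel_le z p.1 p.2

/-! ### Orthogonality -/

lemma pollaczekWeight_cos {θ : ℝ} (hθ : θ ∈ Ioo 0 Real.pi) :
    pollaczekWeight 1 0 (Real.cos θ) = Real.exp (θ * (Real.cos θ / Real.sin θ))
      / (1 + Real.exp (Real.pi * (Real.cos θ / Real.sin θ))) := by
  have hs := Real.sin_pos_of_mem_Ioo hθ
  simp only [pollaczekWeight]
  rw [Real.arccos_cos hθ.1.le hθ.2.le, Real.cosh_eq]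
  set u := Real.cos θ / Real.sin θ with hu
  have h1 : (1 * Real.cos θ + 0) / (2 * Real.sin θ) = u / 2 := by
    rw [hu]; field_simp; ring
  rw [h1]
  have h2 : Real.exp ((2 * θ - Real.pi) * (u / 2))
      = Real.exp (θ * u) * Real.exp (-(Real.pi * (u / 2))) := by
    rw [← Real.exp_add]; ring_nf
  have h3 : Real.exp (Real.pi * u) = Real.exp (Real.pi * (u / 2)) ^ 2 := by
    rw [← Real.exp_nat_mul]; push_cast; ring_nf
  rw [h2, h3, Real.exp_neg]
  have := Real.exp_pos (Real.pi * (u / 2))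
  field_simp
  ring

lemma measurable_pollaczekWeight : Measurable (pollaczekWeight 1 0) := by
  unfold pollaczekWeight
  have := Real.continuous_arccos.measurable
  fun_prop

lemma pollaczekWeight_nonneg (x : ℝ) : 0 ≤ pollaczekWeight 1 0 x := by
  have h := Real.cosh_pos (Real.pi * ((1 * Real.cos (Real.arccos x) + 0)
    / (2 * Real.sin (Real.arccos x))))
  simp only [pollaczekWeight]
  positivity

lemma pollaczekWeight_le_one (x : ℝ) : pollaczekWeight 1 0 x ≤ 1 := by
  simp only [pollaczekWeight]
  generalize (1 * Real.cos (Real.arccos x) + 0) / (2 * Real.sin (Real.arccos x)) = τ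
  have hc := Real.cosh_pos (Real.pi * τ)
  rw [one_div, inv_mul_le_iff₀ (by positivity), mul_one]
  have h0 := Real.arccos_nonneg x
  have h1 := Real.arccos_le_pi x
  have h2 := Real.exp_pos (Real.pi * τ)
  have h3 := Real.exp_pos (-(Real.pi * τ))
  rw [Real.cosh_eq]
  rcases le_total 0 τ with h | h
  · have : Real.exp ((2 * Real.arccos x - Real.pi) * τ) ≤ Real.exp (Real.pi * τ) :=
      Real.exp_le_exp.mpr (by nlinarith)
    linarith
  · have : Real.exp ((2 * Real.arccos x - Real.pi) * τ) ≤ Real.exp (-(Real.pi * τ)) :=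
      Real.exp_le_exp.mpr (by nlinarith)
    linarith

lemma integral_comp_cos (f : ℝ → ℝ) :
    ∫ y in Icc (-1 : ℝ) 1, f y = ∫ θ in Ioo 0 Real.pi, f (Real.cos θ) * Real.sin θ := by
  have himg : Real.cos '' Ioo 0 Real.pi = Ioo (-1) 1 := by
    exact Real.cosPartialHomeomorph.image_source_eq_target
  rw [integral_Icc_eq_integral_Ioo, ← himg,
    integral_image_eq_integral_abs_deriv_smul measurableSet_Ioo
      (fun θ _ => (Real.hasDerivAt_cos θ).hasDerivWithinAt)
      (Real.injOn_cos.mono Ioo_subset_Icc_self)]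
  refine setIntegral_congr_fun measurableSet_Ioo fun θ hθ => ?_
  simp only [smul_eq_mul, abs_neg]
  rw [abs_of_pos (Real.sin_pos_of_mem_Ioo hθ), mul_comm]

/-- Integration of `f` over `[-1, 1]` against the weight. -/
noncomputable def pollaczekIntegral (f : ℝ → ℝ) : ℝ :=
  ∫ y in Icc (-1 : ℝ) 1, f y * pollaczekWeight 1 0 y

lemma integrableOn_mul_pollaczekWeight {f : ℝ → ℝ} (hf : Continuous f) :
    IntegrableOn (fun y => f y * pollaczekWeight 1 0 y) (Icc (-1 : ℝ) 1) := by
  refine (hf.continuousOn.integrableOn_compact isCompact_Icc).mul_bdd (c := 1)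
    measurable_pollaczekWeight.aestronglyMeasurable (.of_forall fun y => ?_)
  rw [Real.norm_of_nonneg (pollaczekWeight_nonneg y)]
  exact pollaczekWeight_le_one y

lemma hasSum_pollaczekIntegral {z : ℝ} (hz : |z| < 1) :
    HasSum (fun j => z ^ j * pollaczekIntegral fun y => pollaczek 1 0 y j) (1 / 2) := by
  obtain ⟨R, h1, h2⟩ := exists_between hz
  have hR := (abs_nonneg z).trans_lt h1
  obtain ⟨B, hB, hs⟩ := exists_pollaczek_bound hR h2
  have hB0 : ∀ j, 0 ≤ B j := fun j => (abs_nonneg _).trans (hB j 0 (by norm_num))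
  have hint : ∀ j, IntegrableOn (fun y => z ^ j * (pollaczek 1 0 y j * pollaczekWeight 1 0 y))
      (Icc (-1 : ℝ) 1) := fun j =>
    (integrableOn_mul_pollaczekWeight (continuous_pollaczek j)).const_mul _
  have hsum := hasSum_integral_of_summable_integral_norm hint (by
    refine Summable.of_nonneg_of_le (fun j => integral_nonneg fun y => norm_nonneg _) (fun j => ?_)
      (hs.mul_left 2)
    have h : ∫ y in Icc (-1 : ℝ) 1, ‖z ^ j * (pollaczek 1 0 y j * pollaczekWeight 1 0 y)‖
        ≤ ∫ y in Icc (-1 : ℝ) 1, (j + 1) * B j * R ^ j := by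
      refine setIntegral_mono_on (hint j).norm (integrableOn_const (by simp)) measurableSet_Icc
        fun y hy => ?_
      rw [norm_mul, norm_mul, norm_pow, Real.norm_eq_abs, Real.norm_eq_abs,
        Real.norm_of_nonneg (pollaczekWeight_nonneg y)]
      calc |z| ^ j * (|pollaczek 1 0 y j| * pollaczekWeight 1 0 y) ≤ R ^ j * (B j * 1) := by
            gcongr
            exacts [mul_nonneg (abs_nonneg _) (pollaczekWeight_nonneg y), pollaczekWeight_nonneg y,
              hB0 j, hB j y hy, pollaczekWeight_le_one y]
        _ ≤ _ := by
          have : 0 ≤ (j : ℝ) * (B j * R ^ j) := by have := hB0 j; positivity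
          linarith
    refine h.trans (le_of_eq ?_)
    simp; norm_num)
  have hval : ∫ y in Icc (-1 : ℝ) 1, ∑' j, z ^ j * (pollaczek 1 0 y j * pollaczekWeight 1 0 y)
      = 1 / 2 := by
    rw [integral_comp_cos, ← integral_pollaczekGen hz]
    refine setIntegral_congr_fun measurableSet_Ioo fun θ hθ => ?_
    rw [← tsum_pollaczek_eq_pollaczekGen hθ hz, ← pollaczekWeight_cos hθ, ← mul_assoc]
    congr 1
    rw [← tsum_mul_right]
    refine tsum_congr fun j => ?_
    ring
  rw [hval] at hsum
  simpa only [integral_const_mul, pollaczekIntegral] using hsum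

/-- Comparison of coefficients in `hasSum_pollaczekIntegral`. -/
lemma pollaczekIntegral_pollaczek (j : ℕ) :
    pollaczekIntegral (fun y => pollaczek 1 0 y j) = if j = 0 then (1 / 2 : ℝ) else 0 := by
  have h1 : HasFPowerSeriesAt (fun _ : ℝ => (1 / 2 : ℝ)) (FormalMultilinearSeries.ofScalars ℝ
      fun j => pollaczekIntegral fun y => pollaczek 1 0 y j) 0 := by
    rw [hasFPowerSeriesAt_iff]
    filter_upwards [Metric.ball_mem_nhds (0 : ℝ) one_pos] with z hz
    simpa using hasSum_pollaczekIntegral (by simpa using hz)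
  have h2 : HasFPowerSeriesAt (fun _ : ℝ => (1 / 2 : ℝ)) (FormalMultilinearSeries.ofScalars ℝ
      fun j : ℕ => if j = 0 then (1 / 2 : ℝ) else 0) 0 := by
    rw [hasFPowerSeriesAt_iff]
    refine .of_forall fun z => ?_
    have := hasSum_ite_eq (0 : ℕ) (1 / 2 : ℝ)
    refine this.congr_fun fun j => ?_
    rcases j with _ | j <;> simp
  have h3 := congrArg (fun p => p.coeff j) (h1.eq_formalMultilinearSeries h2)
  simpa using h3

lemma pollaczekIntegral_add {f g : ℝ → ℝ} (hf : Continuous f) (hg : Continuous g) :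
    pollaczekIntegral (fun y => f y + g y) = pollaczekIntegral f + pollaczekIntegral g := by
  simp only [pollaczekIntegral, add_mul]
  exact integral_add (integrableOn_mul_pollaczekWeight hf) (integrableOn_mul_pollaczekWeight hg)

lemma pollaczekIntegral_const_mul (c : ℝ) (f : ℝ → ℝ) :
    pollaczekIntegral (fun y => c * f y) = c * pollaczekIntegral f := by
  simp only [pollaczekIntegral, mul_assoc]
  exact integral_const_mul _ _

lemma two_mul_mul_pollaczek (y : ℝ) (m : ℕ) :
    2 * y * pollaczek 1 0 y m
      = pollaczek 1 0 y (m + 1) + m / (m + 1) * pollaczek 1 0 y (m - 1) := by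
  rcases m with _ | m
  · simp [pollaczek]; norm_num
  · rw [pollaczek_one_zero_succ_succ, Nat.add_sub_cancel]
    push_cast
    field_simp
    ring

/-- Orthogonality of the polynomials `P_n(x; 1, 0)`. -/
theorem pollaczekIntegral_mul (m n : ℕ) :
    pollaczekIntegral (fun y => pollaczek 1 0 y m * pollaczek 1 0 y n)
      = if m = n then 1 / (2 * ((n : ℝ) + 1)) else 0 := by
  have hc := continuous_pollaczek
  -- multiplication by `2y` is symmetric, which determines all integrals from those with `n = 0`
  have hsymm : ∀ m n : ℕ,
      pollaczekIntegral (fun y => pollaczek 1 0 y (m + 1) * pollaczek 1 0 y n)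
        + m / (m + 1) * pollaczekIntegral (fun y => pollaczek 1 0 y (m - 1) * pollaczek 1 0 y n)
      = pollaczekIntegral (fun y => pollaczek 1 0 y m * pollaczek 1 0 y (n + 1))
        + n / (n + 1)
          * pollaczekIntegral (fun y => pollaczek 1 0 y m * pollaczek 1 0 y (n - 1)) := by
    intro m n
    have h1 := hc m
    have h2 := hc n
    have h3 := hc (m + 1)
    have h4 := hc (n + 1)
    have h5 := hc (m - 1)
    have h6 := hc (n - 1)
    rw [← pollaczekIntegral_const_mul, ← pollaczekIntegral_const_mul,
      ← pollaczekIntegral_add (by fun_prop) (by fun_prop),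
      ← pollaczekIntegral_add (by fun_prop) (by fun_prop)]
    congr 1
    ext y
    linear_combination pollaczek 1 0 y m * two_mul_mul_pollaczek y n
      - pollaczek 1 0 y n * two_mul_mul_pollaczek y m
  induction n using Nat.twoStepInduction generalizing m with
  | zero =>
    have := pollaczekIntegral_pollaczek m
    simp only [pollaczek, mul_one]
    rw [this]
    simp
  | one =>
    have h := hsymm m 0
    have h0 : ∀ m, pollaczekIntegral (fun y => pollaczek 1 0 y m * pollaczek 1 0 y 0)
        = if m = 0 then (1 / 2 : ℝ) else 0 := fun m => by
      rw [← pollaczekIntegral_pollaczek m]; simp [pollaczek]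
    simp only [h0, zero_add] at h
    rcases m with _ | _ | m
    · simp at h ⊢; linarith
    · simp at h ⊢; norm_num at h ⊢; linarith
    · simp at h ⊢; linarith
  | more n ih0 ih1 =>
    have h := hsymm m (n + 1)
    simp only [ih0, ih1, Nat.add_sub_cancel] at h
    have e : pollaczekIntegral (fun y => pollaczek 1 0 y m * pollaczek 1 0 y (n + 2))
      = (if m + 1 = n + 1 then 1 / (2 * (((n + 1 : ℕ) : ℝ) + 1)) else 0)
        + m / (m + 1) * (if m - 1 = n + 1 then 1 / (2 * (((n + 1 : ℕ) : ℝ) + 1)) else 0)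
        - ((n + 1 : ℕ) : ℝ) / (((n + 1 : ℕ) : ℝ) + 1)
          * (if m = n then 1 / (2 * ((n : ℝ) + 1)) else 0) := by
      linarith
    rw [e]
    by_cases h1 : m = n
    · subst h1
      rw [if_pos rfl, if_neg (by omega), if_pos rfl, if_neg (by omega)]
      push_cast
      field_simp
      ring
    · by_cases h2 : m = n + 2
      · subst h2
        rw [if_neg (by omega), if_pos (by omega), if_neg (by omega), if_pos rfl]
        push_cast
        field_simp
        ring
      · rw [if_neg (by omega), if_neg (by omega), if_neg (by omega), if_neg (by omega)]
        ring

/-! ### The measure `ψ` and the polynomials `Q_n` -/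

lemma scaled_mem_Icc {ρ x : ℝ} (hρ : 0 < ρ) (hx : x ∈ psSupport ρ) :
    (1 + ρ) / (2 * √ρ) * x ∈ Icc (-1 : ℝ) 1 := by
  have hs := Real.sqrt_pos.mpr hρ
  obtain ⟨h1, h2⟩ := hx
  rw [← neg_div, div_le_iff₀ (by positivity)] at h1
  rw [le_div_iff₀ (by positivity)] at h2
  rw [div_mul_eq_mul_div]
  constructor
  · rw [le_div_iff₀ (by positivity)]; linarith
  · rw [div_le_iff₀ (by positivity)]; linarith

lemma ae_psMeasure_mem (ρ : ℝ) : ∀ᵐ x ∂psMeasure ρ, x ∈ psSupport ρ :=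
  (withDensity_absolutelyContinuous _ _).ae_le (ae_restrict_mem measurableSet_Icc)

lemma restrict_psMeasure (ρ : ℝ) : (psMeasure ρ).restrict (psSupport ρ) = psMeasure ρ :=
  Measure.restrict_eq_self_of_ae_mem (ae_psMeasure_mem ρ)

lemma measurable_psMeasure_density (ρ : ℝ) : Measurable fun x : ℝ =>
    (1 + ρ) / √ρ * pollaczekWeight 1 0 ((1 + ρ) / (2 * √ρ) * x) :=
  (measurable_pollaczekWeight.comp (measurable_const_mul _)).const_mul _

lemma isFiniteMeasure_psMeasure {ρ : ℝ} (hρ : 0 < ρ) : IsFiniteMeasure (psMeasure ρ) := by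
  refine isFiniteMeasure_withDensity (ne_of_lt ?_)
  have hle : ∀ x, ENNReal.ofReal ((1 + ρ) / √ρ * pollaczekWeight 1 0 ((1 + ρ) / (2 * √ρ) * x))
      ≤ ENNReal.ofReal ((1 + ρ) / √ρ) := fun x =>
    ENNReal.ofReal_le_ofReal (mul_le_of_le_one_right (by positivity) (pollaczekWeight_le_one _))
  refine (lintegral_mono hle).trans_lt ?_
  rw [lintegral_const]
  refine ENNReal.mul_lt_top ENNReal.ofReal_lt_top ?_
  simp [psSupport]

lemma integrable_psMeasure_of_continuousOn {ρ : ℝ} (hρ : 0 < ρ) {f : ℝ → ℝ}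
    (hf : ContinuousOn f (psSupport ρ)) : Integrable f (psMeasure ρ) := by
  have := isFiniteMeasure_psMeasure hρ
  have h : IntegrableOn f (psSupport ρ) (psMeasure ρ) := hf.integrableOn_compact isCompact_Icc
  rwa [IntegrableOn, restrict_psMeasure] at h

lemma integral_psMeasure {ρ : ℝ} (hρ : 0 < ρ) (f : ℝ → ℝ) :
    ∫ x, f x ∂psMeasure ρ = 2 * pollaczekIntegral fun y => f (2 * √ρ / (1 + ρ) * y) := by
  have hs := Real.sqrt_pos.mpr hρ
  have hc : 0 < 2 * √ρ / (1 + ρ) := by positivity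
  rw [psMeasure, integral_withDensity_eq_integral_toReal_smul
    (measurable_psMeasure_density ρ).ennreal_ofReal (by simp)]
  set c := 2 * √ρ / (1 + ρ) with hcdef
  have hinv : (1 + ρ) / (2 * √ρ) = c⁻¹ := by rw [hcdef, inv_div]
  have hg : ∀ x, (ENNReal.ofReal
      ((1 + ρ) / √ρ * pollaczekWeight 1 0 ((1 + ρ) / (2 * √ρ) * x))).toReal • f x
        = 2 / c * (f (c * (x / c)) * pollaczekWeight 1 0 (x / c)) := by
    intro x
    rw [ENNReal.toReal_ofReal (mul_nonneg (by positivity) (pollaczekWeight_nonneg _)), hinv,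
      mul_div_cancel₀ _ hc.ne', smul_eq_mul, inv_mul_eq_div]
    have : 2 / c = (1 + ρ) / √ρ := by rw [hcdef]; field_simp
    rw [this]; ring
  simp only [hg]
  rw [psSupport, integral_const_mul, integral_Icc_eq_integral_Ioc,
    ← intervalIntegral.integral_of_le (by linarith),
    intervalIntegral.integral_comp_div (fun y => f (c * y) * pollaczekWeight 1 0 y) hc.ne',
    neg_div, div_self hc.ne', intervalIntegral.integral_of_le (by norm_num),
    ← integral_Icc_eq_integral_Ioc, pollaczekIntegral, smul_eq_mul, ← mul_assoc,
    div_mul_cancel₀ _ hc.ne']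

lemma continuous_psQ (ρ : ℝ) (m : ℕ) : Continuous (psQ ρ m) := by
  unfold psQ
  have := (continuous_pollaczek m).comp (continuous_const_mul ((1 + ρ) / (2 * √ρ)))
  exact continuous_const.mul this

/-- Multiplication by `x` acts on the polynomials as the transition matrix of the chain, restricted
to the states `0, 1, 2, …`. -/
lemma mul_psQ {ρ : ℝ} (hρ : 0 < ρ) (x : ℝ) (m : ℕ) :
    x * psQ ρ m x = ρ / (1 + ρ) * psQ ρ (m + 1) x
      + m / ((m + 1) * (1 + ρ)) * psQ ρ (m - 1) x := by
  have hs := Real.sqrt_pos.mpr hρ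
  have hsq := Real.sq_sqrt hρ.le
  have h := two_mul_mul_pollaczek ((1 + ρ) / (2 * √ρ) * x) m
  unfold psQ
  generalize pollaczek 1 0 ((1 + ρ) / (2 * √ρ) * x) m = p at h ⊢
  generalize pollaczek 1 0 ((1 + ρ) / (2 * √ρ) * x) (m + 1) = p1 at h ⊢
  have hρs : ρ / (1 + ρ) = √ρ ^ 2 / (1 + ρ) := by rw [hsq]
  rw [hρs]
  rcases m with _ | m
  · simp at h ⊢
    field_simp at h ⊢
    linear_combination h
  · rw [Nat.add_sub_cancel] at h ⊢
    generalize pollaczek 1 0 ((1 + ρ) / (2 * √ρ) * x) m = p0 at h ⊢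
    push_cast at h ⊢
    field_simp at h ⊢
    linear_combination √ρ ^ (2 * m + 2) * h

lemma integral_psQ_mul_psQ {ρ : ℝ} (hρ : 0 < ρ) (m n : ℕ) :
    ∫ x, psQ ρ m x * psQ ρ n x ∂psMeasure ρ = if m = n then 1 / (ρ ^ n * (n + 1)) else 0 := by
  have hs := Real.sqrt_pos.mpr hρ
  have h1 : ∀ y : ℝ, (1 + ρ) / (2 * √ρ) * (2 * √ρ / (1 + ρ) * y) = y := fun y => by
    field_simp
  have h2 : ∀ y : ℝ, psQ ρ m (2 * √ρ / (1 + ρ) * y) * psQ ρ n (2 * √ρ / (1 + ρ) * y)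
      = 1 / (√ρ ^ m * √ρ ^ n) * (pollaczek 1 0 y m * pollaczek 1 0 y n) := fun y => by
    rw [psQ, psQ, h1]; field_simp
  rw [integral_psMeasure hρ]
  simp only [h2]
  rw [pollaczekIntegral_const_mul, pollaczekIntegral_mul]
  split_ifs with h
  · rw [h, ← mul_pow, Real.mul_self_sqrt hρ.le]
    field_simp
  · simp

/-- Integration term by term of a uniformly convergent series of continuous functions. -/
lemma hasSum_integral_psMeasure {ρ : ℝ} (hρ : 0 < ρ) {F : ℕ → ℝ → ℝ} {b : ℕ → ℝ}
    (hF : ∀ i, ContinuousOn (F i) (psSupport ρ)) (hb : ∀ i, ∀ x ∈ psSupport ρ, |F i x| ≤ b i)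
    (hs : Summable b) :
    Integrable (fun x => ∑' i, F i x) (psMeasure ρ) ∧
      HasSum (fun i => ∫ x, F i x ∂psMeasure ρ) (∫ x, ∑' i, F i x ∂psMeasure ρ) := by
  have := isFiniteMeasure_psMeasure hρ
  refine ⟨integrable_psMeasure_of_continuousOn hρ (continuousOn_tsum hF hs hb),
    hasSum_integral_of_summable_integral_norm
      (fun i => integrable_psMeasure_of_continuousOn hρ (hF i)) ?_⟩
  refine Summable.of_nonneg_of_le (fun i => integral_nonneg fun y => norm_nonneg _) (fun i => ?_)
    (hs.mul_left ((psMeasure ρ).real univ))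
  have h : ∫ x, ‖F i x‖ ∂psMeasure ρ ≤ ∫ _, b i ∂psMeasure ρ := by
    refine integral_mono_ae (integrable_psMeasure_of_continuousOn hρ (hF i)).norm
      (integrable_const _) ?_
    filter_upwards [ae_psMeasure_mem ρ] with x hx using hb i x hx
  rwa [integral_const, smul_eq_mul] at h

lemma psQ_mul_pow {ρ : ℝ} (hρ : 0 < ρ) (m : ℕ) (x : ℝ) :
    psQ ρ m x * ρ ^ m = pollaczek 1 0 ((1 + ρ) / (2 * √ρ) * x) m * √ρ ^ m := by
  have hs := Real.sqrt_pos.mpr hρ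
  have : ρ ^ m = √ρ ^ m * √ρ ^ m := by rw [← mul_pow, Real.mul_self_sqrt hρ.le]
  rw [psQ, this]
  field_simp

lemma sqrt_lt_one_of_lt_one {ρ : ℝ} (hρ1 : ρ < 1) : √ρ < 1 := by
  rw [Real.sqrt_lt' one_pos]; linarith

lemma summable_psQ_mul_pow {ρ : ℝ} (hρ : 0 < ρ) (hρ1 : ρ < 1) {x : ℝ} (hx : x ∈ psSupport ρ) :
    Summable fun m : ℕ => psQ ρ m x * ρ ^ m := by
  simp only [psQ_mul_pow hρ]
  refine summable_pollaczek_mul_pow ?_ (scaled_mem_Icc hρ hx)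
  rw [abs_of_nonneg (Real.sqrt_nonneg ρ)]
  exact sqrt_lt_one_of_lt_one hρ1

lemma exists_abs_psQ_le (ρ : ℝ) (n : ℕ) : ∃ M, ∀ x ∈ psSupport ρ, |psQ ρ n x| ≤ M :=
  isCompact_Icc.exists_bound_of_continuousOn (continuous_psQ ρ n).continuousOn

lemma abs_le_of_mem_psSupport {ρ x : ℝ} (hx : x ∈ psSupport ρ) : |x| ≤ 2 * √ρ / (1 + ρ) :=
  abs_le.mpr hx

lemma psSupport_bound_lt_one {ρ : ℝ} (hρ : 0 < ρ) (hρ1 : ρ < 1) : 2 * √ρ / (1 + ρ) < 1 := by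
  have := sqrt_lt_one_of_lt_one hρ1
  rw [div_lt_one (by positivity)]
  nlinarith [Real.sq_sqrt hρ.le]

/-- The geometric series converges uniformly, as the support lies inside `(-1, 1)`. -/
lemma hasSum_integral_psQ_div {ρ : ℝ} (hρ : 0 < ρ) (hρ1 : ρ < 1) (m n : ℕ) :
    Integrable (fun x => psQ ρ m x * psQ ρ n x / (1 - x)) (psMeasure ρ) ∧
      HasSum (fun k : ℕ => ∫ x, x ^ k * psQ ρ m x * psQ ρ n x ∂psMeasure ρ)
        (∫ x, psQ ρ m x * psQ ρ n x / (1 - x) ∂psMeasure ρ) := by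
  obtain ⟨M, hM⟩ := exists_abs_psQ_le ρ m
  obtain ⟨L, hL⟩ := exists_abs_psQ_le ρ n
  have hc := psSupport_bound_lt_one hρ hρ1
  have hc0 : 0 ≤ 2 * √ρ / (1 + ρ) := by positivity
  have h := hasSum_integral_psMeasure hρ (F := fun k x => x ^ k * psQ ρ m x * psQ ρ n x)
    (b := fun k => (2 * √ρ / (1 + ρ)) ^ k * M * L)
    (fun k => (((continuous_pow k).mul (continuous_psQ ρ m)).mul
      (continuous_psQ ρ n)).continuousOn)
    (fun k x hx => by
      rw [abs_mul, abs_mul, abs_pow]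
      have h1 := abs_le_of_mem_psSupport hx
      have h2 := hM x hx
      have h3 := hL x hx
      have h4 := (abs_nonneg _).trans h2
      gcongr)
    (((summable_geometric_of_lt_one hc0 hc).mul_right M).mul_right L)
  have hae : (fun x => ∑' k : ℕ, x ^ k * psQ ρ m x * psQ ρ n x)
      =ᵐ[psMeasure ρ] fun x => psQ ρ m x * psQ ρ n x / (1 - x) := by
    filter_upwards [ae_psMeasure_mem ρ] with x hx
    have hx1 : ‖x‖ < 1 := (abs_le_of_mem_psSupport hx).trans_lt hc
    rw [tsum_mul_right, tsum_mul_right, tsum_geometric_of_norm_lt_one hx1]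
    ring
  rw [integrable_congr hae, integral_congr_ae hae] at h
  exact h

lemma hasSum_integral_psGen {ρ : ℝ} (hρ : 0 < ρ) (hρ1 : ρ < 1) (k n : ℕ) :
    Integrable (fun x => x ^ k * psGen ρ x ρ * psQ ρ n x) (psMeasure ρ) ∧
      HasSum (fun m : ℕ => ρ ^ m * ∫ x, x ^ k * psQ ρ m x * psQ ρ n x ∂psMeasure ρ)
        (∫ x, x ^ k * psGen ρ x ρ * psQ ρ n x ∂psMeasure ρ) := by
  obtain ⟨L, hL⟩ := exists_abs_psQ_le ρ n
  obtain ⟨B, hB, hs⟩ := exists_pollaczek_bound (Real.sqrt_pos.mpr hρ) (sqrt_lt_one_of_lt_one hρ1)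
  have hB0 : ∀ j, 0 ≤ B j := fun j => (abs_nonneg _).trans (hB j 0 (by norm_num))
  have hc := psSupport_bound_lt_one hρ hρ1
  have h := hasSum_integral_psMeasure hρ
    (F := fun m x => ρ ^ m * (x ^ k * psQ ρ m x * psQ ρ n x))
    (b := fun m => (m + 1) * B m * √ρ ^ m * L)
    (fun m => (continuous_const.mul (((continuous_pow k).mul (continuous_psQ ρ m)).mul
      (continuous_psQ ρ n))).continuousOn)
    (fun m x hx => by
      have e : ρ ^ m * (x ^ k * psQ ρ m x * psQ ρ n x)
          = x ^ k * (pollaczek 1 0 ((1 + ρ) / (2 * √ρ) * x) m * √ρ ^ m) * psQ ρ n x := by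
        rw [← psQ_mul_pow hρ]; ring
      rw [e, abs_mul, abs_mul, abs_mul, abs_pow, abs_pow, abs_of_nonneg (Real.sqrt_nonneg ρ)]
      have h1 : |x| ^ k ≤ 1 :=
        pow_le_one₀ (abs_nonneg x) ((abs_le_of_mem_psSupport hx).trans hc.le)
      have h2 := hB m _ (scaled_mem_Icc hρ hx)
      have h3 := hL x hx
      have h4 := hB0 m
      calc _ ≤ 1 * (B m * √ρ ^ m) * L := by gcongr
        _ ≤ (m + 1) * (B m * √ρ ^ m) * L := by
          have : 0 ≤ L := (abs_nonneg _).trans h3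
          gcongr
          have : (0 : ℝ) ≤ m := Nat.cast_nonneg m
          linarith
        _ = _ := by ring)
    (hs.mul_right L)
  have e : ∀ x, ∑' m : ℕ, ρ ^ m * (x ^ k * psQ ρ m x * psQ ρ n x)
      = x ^ k * psGen ρ x ρ * psQ ρ n x := fun x => by
    rw [psGen, ← tsum_mul_left, ← tsum_mul_right]
    exact tsum_congr fun m => by ring
  simpa only [e, integral_const_mul] using h

/-! ### Markov chains and events determined by a path -/

section Chain

variable {Ω : Type*}

section Measure

variable [MeasurableSpace Ω] {P : Measure Ω}

lemma cond_measureReal {A : Set Ω} (hA : MeasurableSet A) (E : Set Ω) :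
    (cond P A).real E = (P.real A)⁻¹ * P.real (A ∩ E) := by
  rw [measureReal_def, cond_apply hA, ENNReal.toReal_mul, ENNReal.toReal_inv]
  rfl

lemma hasSum_measureReal_iUnion [IsProbabilityMeasure P] {ι : Type*} [Countable ι] {E : ι → Set Ω}
    (hE : ∀ i, MeasurableSet (E i)) (hd : Pairwise fun i j => Disjoint (E i) (E j)) :
    HasSum (fun i => P.real (E i)) (P.real (⋃ i, E i)) := by
  rw [measureReal_def, measure_iUnion hd hE, ENNReal.tsum_toReal_eq fun i => measure_ne_top P _]
  refine (ENNReal.summable_toReal ?_).hasSum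
  rw [← measure_iUnion hd hE]
  exact measure_ne_top P _

/-- The law of total probability. -/
lemma hasSum_measureReal_inter_fiber [IsProbabilityMeasure P] {S : Type*} [Countable S] {X : Ω → S}
    (hX : ∀ s, MeasurableSet {ω | X ω = s}) {E : Set Ω} (hE : MeasurableSet E) :
    HasSum (fun s => P.real (E ∩ {ω | X ω = s})) (P.real E) := by
  have h := hasSum_measureReal_iUnion (P := P) (fun s => hE.inter (hX s)) (fun s t hst =>
    Set.disjoint_left.mpr fun ω h1 h2 => hst (h1.2.symm.trans h2.2))
  have hU : ⋃ s, E ∩ {ω | X ω = s} = E := by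
    ext ω; simp
  rwa [hU] at h

namespace IsMarkovChain

variable {S : Type*} {p : Matrix S S ℝ} {N : ℕ → Ω → S}

lemma measurableSet_path_eq (hN : IsMarkovChain P p N) (k : ℕ) (f : Fin (k + 1) → S) :
    MeasurableSet {ω | (fun i : Fin (k + 1) => N i ω) = f} := by
  have : {ω | (fun i : Fin (k + 1) => N i ω) = f} = ⋂ i : Fin (k + 1), {ω | N i ω = f i} := by
    ext ω; simp [funext_iff]
  rw [this]
  exact MeasurableSet.iInter fun i => hN.measurableSet_eq _ _

lemma measurableSet_path [Countable S] (hN : IsMarkovChain P p N) (k : ℕ)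
    (B : Set (Fin (k + 1) → S)) :
    MeasurableSet {ω | (fun i : Fin (k + 1) => N i ω) ∈ B} := by
  have : {ω | (fun i : Fin (k + 1) => N i ω) ∈ B}
      = ⋃ f ∈ B, {ω | (fun i : Fin (k + 1) => N i ω) = f} := by
    ext ω; simp
  rw [this]
  exact MeasurableSet.biUnion (to_countable B) fun f _ => hN.measurableSet_path_eq k f

/-- The Markov property, conditionally on an event `B` determined by the states up to time `k`. -/
lemma measureReal_path_step [IsProbabilityMeasure P] [Countable S] (hN : IsMarkovChain P p N)
    (k : ℕ) (B : Set (Fin (k + 1) → S)) (s t : S) :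
    P.real {ω | (fun i : Fin (k + 1) => N i ω) ∈ B ∧ N k ω = s ∧ N (k + 1) ω = t} =
      P.real {ω | (fun i : Fin (k + 1) => N i ω) ∈ B ∧ N k ω = s} * p s t := by
  have hE' : MeasurableSet {ω | (fun i : Fin (k + 1) => N i ω) ∈ B ∧ N k ω = s} :=
    (hN.measurableSet_path k B).inter (hN.measurableSet_eq k s)
  have hE : MeasurableSet
      {ω | (fun i : Fin (k + 1) => N i ω) ∈ B ∧ N k ω = s ∧ N (k + 1) ω = t} :=
    (hN.measurableSet_path k B).inter
      ((hN.measurableSet_eq k s).inter (hN.measurableSet_eq (k + 1) t))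
  have h1 := hasSum_measureReal_inter_fiber (P := P) (hN.measurableSet_path_eq k) hE
  have h2 := (hasSum_measureReal_inter_fiber (P := P) (hN.measurableSet_path_eq k) hE').mul_right
    (p s t)
  refine h1.unique (h2.congr_fun fun f => ?_)
  by_cases hf : f ∈ B ∧ f (Fin.last k) = s
  · set f' : ℕ → S := fun i => if h : i < k + 1 then f ⟨i, h⟩ else s with hf'
    have hiff : ∀ ω, (fun i : Fin (k + 1) => N i ω) = f ↔ ∀ i ≤ k, N i ω = f' i := by
      intro ω
      rw [funext_iff, Fin.forall_iff]
      refine forall_congr' fun i => ⟨fun h hi => ?_, fun h hi => ?_⟩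
      · have hi' : i < k + 1 := Nat.lt_succ_of_le hi
        rw [hf']; simp only [hi', dif_pos]; exact h hi'
      · have := h (Nat.le_of_lt_succ hi)
        rw [hf'] at this; simp only [hi, dif_pos] at this; exact this
    have hk : f' k = s := by
      rw [← hf.2, hf']; simp [Fin.last]
    have e1 : {ω | (fun i : Fin (k + 1) => N i ω) ∈ B ∧ N k ω = s ∧ N (k + 1) ω = t}
        ∩ {ω | (fun i : Fin (k + 1) => N i ω) = f}
        = {ω | (∀ i ≤ k, N i ω = f' i) ∧ N (k + 1) ω = t} := by
      ext ω
      simp only [mem_inter_iff, mem_ofPred_eq]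
      rw [← hiff]
      refine ⟨fun h => ⟨h.2, h.1.2.2⟩, fun h => ⟨⟨h.1 ▸ hf.1, ?_, h.2⟩, h.1⟩⟩
      rw [← hk]; exact (hiff ω).mp h.1 k le_rfl
    have e2 : {ω | (fun i : Fin (k + 1) => N i ω) ∈ B ∧ N k ω = s}
        ∩ {ω | (fun i : Fin (k + 1) => N i ω) = f} = {ω | ∀ i ≤ k, N i ω = f' i} := by
      ext ω
      simp only [mem_inter_iff, mem_ofPred_eq]
      rw [← hiff]
      refine ⟨fun h => h.2, fun h => ⟨⟨h ▸ hf.1, ?_⟩, h⟩⟩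
      rw [← hk]; exact (hiff ω).mp h k le_rfl
    rw [e1, e2, hN.markov k f' t, hk]
  · have e2 : {ω | (fun i : Fin (k + 1) => N i ω) ∈ B ∧ N k ω = s}
        ∩ {ω | (fun i : Fin (k + 1) => N i ω) = f} = ∅ := by
      ext ω
      simp only [mem_inter_iff, mem_ofPred_eq, mem_empty_iff_false, iff_false]
      rintro ⟨⟨h1, h2⟩, h3⟩
      exact hf (h3 ▸ ⟨h1, by simpa using h2⟩)
    have e1 : {ω | (fun i : Fin (k + 1) => N i ω) ∈ B ∧ N k ω = s ∧ N (k + 1) ω = t}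
        ∩ {ω | (fun i : Fin (k + 1) => N i ω) = f} = ∅ :=
      eq_empty_of_subset_empty (e2 ▸ inter_subset_inter_left _ fun ω h => ⟨h.1, h.2.1⟩)
    rw [e1, e2]
    simp

end IsMarkovChain

end Measure

/-! ### The transition probabilities before absorption -/

/-- The event that the chain starts at `n` and has not been absorbed by time `k`. -/
def aliveFrom (N : ℕ → Ω → Option ℕ) (n k : ℕ) : Set Ω :=
  {ω | N 0 ω = some n ∧ ∀ i ≤ k, N i ω ≠ none}

lemma aliveFrom_eq_path (N : ℕ → Ω → Option ℕ) (n k : ℕ) :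
    aliveFrom N n k = {ω | (fun i : Fin (k + 1) => N i ω) ∈
      {f : Fin (k + 1) → Option ℕ | f 0 = some n ∧ ∀ i, f i ≠ none}} := by
  ext ω
  simp only [aliveFrom, mem_ofPred_eq, Fin.forall_iff, Fin.val_zero, Nat.lt_succ_iff]

lemma departureIndex_eq_iff (N : ℕ → Ω → Option ℕ) (ω : Ω) (k : ℕ) :
    departureIndex N ω = (k : WithTop ℕ) ↔ N k ω = none ∧ ∀ i < k, N i ω ≠ none := by
  rw [departureIndex, hittingAfter]
  split_ifs with h
  · simp only [zero_le, true_and, mem_singleton_iff] at h ⊢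
    have hmem : N (sInf {i | N i ω = none}) ω = none := Nat.sInf_mem (s := {i | N i ω = none}) h
    rw [← WithTop.coe_natCast, WithTop.coe_eq_coe, Nat.cast_id]
    constructor
    · rintro rfl
      exact ⟨hmem, fun i hi hi' => Nat.notMem_of_lt_sInf hi hi'⟩
    · rintro ⟨h1, h2⟩
      refine le_antisymm (Nat.sInf_le h1) ?_
      by_contra hlt
      exact h2 _ (not_le.mp hlt) hmem
  · refine iff_of_false (WithTop.top_ne_coe) fun h' => h ⟨k, Nat.zero_le k, h'.1⟩

lemma leftBehind_of_departureIndex_eq {N : ℕ → Ω → Option ℕ} {ω : Ω} {k : ℕ}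
    (h : departureIndex N ω = (k : WithTop ℕ)) : leftBehind N ω = N (k - 1) ω := by
  rw [leftBehind, h]
  rfl

lemma exists_departureIndex_eq {N : ℕ → Ω → Option ℕ} {ω : Ω} {m : ℕ}
    (h : leftBehind N ω = some m) :
    ∃ k : ℕ, departureIndex N ω = ((k + 1 : ℕ) : WithTop ℕ) := by
  rcases hd : departureIndex N ω with _ | k
  · rw [leftBehind, hd] at h
    simp at h
  · rcases k with _ | k
    · have h1 := (departureIndex_eq_iff N ω 0).mp hd
      rw [leftBehind_of_departureIndex_eq hd, h1.1] at h
      simp at h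
    · exact ⟨k, rfl⟩

/-- On `{N_0 = n}`, the event `{κ = k + 1, ν = m}` says that the chain is in `m` at time `k`, not
having been absorbed before, and is absorbed in the next step. -/
lemma departure_event_eq (N : ℕ → Ω → Option ℕ) (n k m : ℕ) :
    {ω | N 0 ω = some n} ∩ {ω | departureIndex N ω = ((k + 1 : ℕ) : WithTop ℕ) ∧
      leftBehind N ω = some m} =
      aliveFrom N n k ∩ {ω | N k ω = some m} ∩ {ω | N (k + 1) ω = none} := by
  ext ω
  simp only [aliveFrom, mem_inter_iff, mem_ofPred_eq]
  constructor
  · rintro ⟨h0, h1, h2⟩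
    rw [leftBehind_of_departureIndex_eq h1] at h2
    rw [departureIndex_eq_iff] at h1
    exact ⟨⟨⟨h0, fun i hi => h1.2 i (by omega)⟩, h2⟩, h1.1⟩
  · rintro ⟨⟨⟨h0, h1⟩, h2⟩, h3⟩
    have hd : departureIndex N ω = ((k + 1 : ℕ) : WithTop ℕ) :=
      (departureIndex_eq_iff N ω (k + 1)).mpr ⟨h3, fun i hi => h1 i (by omega)⟩
    exact ⟨h0, hd, by rw [leftBehind_of_departureIndex_eq hd]; exact h2⟩

lemma psMatrix_some_some_eq_zero {ρ : ℝ} {i j : ℕ} (h1 : j ≠ i + 1) (h2 : j + 1 ≠ i) :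
    psMatrix ρ (some i) (some j) = 0 := by
  simp [psMatrix, h1, h2]

lemma psMatrix_some_succ (ρ : ℝ) (i : ℕ) : psMatrix ρ (some i) (some (i + 1)) = ρ / (1 + ρ) := by
  simp [psMatrix]

lemma psMatrix_succ_some (ρ : ℝ) (i : ℕ) :
    psMatrix ρ (some (i + 1)) (some i) = (i + 1) / ((i + 2) * (1 + ρ)) := by
  have h : i ≠ i + 1 + 1 := by omega
  simp only [psMatrix, if_neg h, if_true]
  push_cast
  ring

variable [MeasurableSpace Ω] {P : Measure Ω} {N : ℕ → Ω → Option ℕ} {ρ : ℝ}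

lemma measurableSet_aliveFrom (hN : IsMarkovChain P (psMatrix ρ) N) (n k : ℕ) :
    MeasurableSet (aliveFrom N n k) := by
  rw [aliveFrom_eq_path]
  exact hN.measurableSet_path k _

lemma measureReal_aliveFrom_step [IsProbabilityMeasure P] (hN : IsMarkovChain P (psMatrix ρ) N)
    (n k : ℕ) (s t : Option ℕ) :
    P.real (aliveFrom N n k ∩ {ω | N k ω = s} ∩ {ω | N (k + 1) ω = t}) =
      P.real (aliveFrom N n k ∩ {ω | N k ω = s}) * psMatrix ρ s t := by
  have h := hN.measureReal_path_step k
    {f : Fin (k + 1) → Option ℕ | f 0 = some n ∧ ∀ i, f i ≠ none} s t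
  rw [inter_assoc, aliveFrom_eq_path]
  exact h

/-- The forward equation of the chain before absorption. -/
lemma hasSum_measureReal_aliveFrom [IsProbabilityMeasure P]
    (hN : IsMarkovChain P (psMatrix ρ) N) (n k m : ℕ) :
    HasSum (fun s => P.real (aliveFrom N n k ∩ {ω | N k ω = s}) * psMatrix ρ s (some m))
      (P.real (aliveFrom N n (k + 1) ∩ {ω | N (k + 1) ω = some m})) := by
  have h := hasSum_measureReal_inter_fiber (P := P) (X := N k) (hN.measurableSet_eq k)
    ((measurableSet_aliveFrom hN n (k + 1)).inter (hN.measurableSet_eq (k + 1) (some m)))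
  refine h.congr_fun fun s => ?_
  rw [← measureReal_aliveFrom_step hN]
  congr 1
  ext ω
  simp only [aliveFrom, mem_inter_iff, mem_ofPred_eq]
  constructor
  · rintro ⟨⟨⟨h0, h1⟩, h2⟩, h3⟩
    exact ⟨⟨⟨h0, fun i hi => by
      rcases Nat.le_succ_iff.mp hi with h | h
      · exact h1 i h
      · rw [h, h3]; simp⟩, h3⟩, h2⟩
  · rintro ⟨⟨⟨h0, h1⟩, h2⟩, h3⟩
    exact ⟨⟨⟨h0, fun i hi => h1 i (by omega)⟩, h3⟩, h2⟩

/-- The `k`-step transition probabilities, in terms of the moments of `Q_m Q_n`. -/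
lemma measureReal_aliveFrom_eq [IsProbabilityMeasure P]
    (hρ : 0 < ρ) (hN : IsMarkovChain P (psMatrix ρ) N) (n k m : ℕ) :
    P.real (aliveFrom N n k ∩ {ω | N k ω = some m}) = P.real {ω | N 0 ω = some n} *
      (ρ ^ m * (m + 1) * ∫ x, x ^ k * psQ ρ m x * psQ ρ n x ∂psMeasure ρ) := by
  induction k generalizing m with
  | zero =>
    simp only [pow_zero, one_mul]
    rw [integral_psQ_mul_psQ hρ]
    split_ifs with h
    · subst h
      have : aliveFrom N m 0 ∩ {ω | N 0 ω = some m} = {ω | N 0 ω = some m} := by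
        ext ω
        simp only [aliveFrom, mem_inter_iff, mem_ofPred_eq, Nat.le_zero, forall_eq]
        constructor
        · exact fun h => h.2
        · intro h; simp [h]
      rw [this]
      field_simp
    · have : aliveFrom N n 0 ∩ {ω | N 0 ω = some m} = ∅ := by
        ext ω
        simp only [aliveFrom, mem_inter_iff, mem_ofPred_eq, mem_empty_iff_false, iff_false]
        rintro ⟨⟨h1, _⟩, h2⟩
        rw [h1] at h2
        exact h (Option.some_injective _ h2).symm
      rw [this]
      simp
  | succ k ih =>
    have hsum := hasSum_measureReal_aliveFrom hN n k m
    have hnone : aliveFrom N n k ∩ {ω | N k ω = none} = ∅ := by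
      ext ω
      simp only [aliveFrom, mem_inter_iff, mem_ofPred_eq, mem_empty_iff_false, iff_false]
      rintro ⟨⟨_, h1⟩, h2⟩
      exact h1 k le_rfl h2
    have hint : ∀ j, Integrable (fun x => x ^ k * psQ ρ j x * psQ ρ n x) (psMeasure ρ) :=
      fun j => integrable_psMeasure_of_continuousOn hρ
        (((continuous_pow k).mul (continuous_psQ ρ j)).mul (continuous_psQ ρ n)).continuousOn
    have hrec : ∫ x, x ^ (k + 1) * psQ ρ m x * psQ ρ n x ∂psMeasure ρ
        = ρ / (1 + ρ) * ∫ x, x ^ k * psQ ρ (m + 1) x * psQ ρ n x ∂psMeasure ρ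
          + m / ((m + 1) * (1 + ρ)) * ∫ x, x ^ k * psQ ρ (m - 1) x * psQ ρ n x ∂psMeasure ρ := by
      rw [← integral_const_mul, ← integral_const_mul,
        ← integral_add ((hint _).const_mul _) ((hint _).const_mul _)]
      refine integral_congr_ae (.of_forall fun x => ?_)
      beta_reduce
      linear_combination x ^ k * psQ ρ n x * mul_psQ hρ x m
    rw [hrec]
    rcases m with _ | m
    · have h1 := hsum.unique (hasSum_single (some 1) fun s hs => by
        rcases s with _ | j
        · rw [hnone]; simp
        · rw [psMatrix_some_some_eq_zero (by omega) (by rintro rfl; exact hs rfl), mul_zero])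
      rw [h1, ih, show (1 : ℕ) = 0 + 1 from rfl, psMatrix_succ_some]
      push_cast
      field_simp
      ring
    · have h1 := hsum.unique (hasSum_sum_of_ne_finset_zero (s := {some m, some (m + 2)})
        fun s hs => by
        rcases s with _ | j
        · rw [hnone]; simp
        · simp only [Finset.mem_insert, Finset.mem_singleton, Option.some.injEq, not_or] at hs
          rw [psMatrix_some_some_eq_zero (by omega) (by omega), mul_zero])
      rw [Finset.sum_pair (by simp)] at h1
      rw [h1, ih, ih, psMatrix_some_succ, psMatrix_succ_some, Nat.add_sub_cancel]
      push_cast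
      field_simp
      ring

/-! ### The laws of `κ` and `ν` -/

lemma measurableSet_departure_event (hN : IsMarkovChain P (psMatrix ρ) N) (n k m : ℕ) :
    MeasurableSet ({ω | N 0 ω = some n} ∩
      {ω | departureIndex N ω = ((k + 1 : ℕ) : WithTop ℕ) ∧ leftBehind N ω = some m}) := by
  rw [departure_event_eq]
  exact ((measurableSet_aliveFrom hN n k).inter (hN.measurableSet_eq _ _)).inter
    (hN.measurableSet_eq _ _)

lemma cond_departure_event [IsProbabilityMeasure P] (hρ : 0 < ρ)
    (hN : IsMarkovChain P (psMatrix ρ) N) {n : ℕ} (hn : P {ω | N 0 ω = some n} ≠ 0) (k m : ℕ) :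
    (cond P {ω | N 0 ω = some n}).real {ω | departureIndex N ω = ((k + 1 : ℕ) : WithTop ℕ) ∧
        leftBehind N ω = some m} =
      ρ ^ m / (1 + ρ) * ∫ x, x ^ k * psQ ρ m x * psQ ρ n x ∂psMeasure ρ := by
  have hp : P.real {ω | N 0 ω = some n} ≠ 0 :=
    ENNReal.toReal_ne_zero.mpr ⟨hn, measure_ne_top P _⟩
  rw [cond_measureReal (hN.measurableSet_eq 0 (some n)), departure_event_eq,
    measureReal_aliveFrom_step hN, measureReal_aliveFrom_eq hρ hN]
  simp only [psMatrix]
  field_simp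

lemma cond_hasSum_leftBehind [IsProbabilityMeasure P]
    (hN : IsMarkovChain P (psMatrix ρ) N) (n m : ℕ) :
    HasSum (fun k : ℕ => (cond P {ω | N 0 ω = some n}).real
        {ω | departureIndex N ω = ((k + 1 : ℕ) : WithTop ℕ) ∧ leftBehind N ω = some m})
      ((cond P {ω | N 0 ω = some n}).real {ω | leftBehind N ω = some m}) := by
  simp only [cond_measureReal (hN.measurableSet_eq 0 (some n))]
  refine HasSum.mul_left _ ?_
  have h := hasSum_measureReal_iUnion (P := P)
    (fun k => measurableSet_departure_event hN n k m) (fun k l hkl => by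
      refine Set.disjoint_left.mpr fun ω h1 h2 => hkl ?_
      have := h1.2.1.symm.trans h2.2.1
      rw [Nat.cast_inj] at this
      omega)
  have hU : {ω | N 0 ω = some n} ∩ {ω | leftBehind N ω = some m} =
      ⋃ k : ℕ, {ω | N 0 ω = some n} ∩
        {ω | departureIndex N ω = ((k + 1 : ℕ) : WithTop ℕ) ∧ leftBehind N ω = some m} := by
    ext ω
    simp only [mem_inter_iff, mem_ofPred_eq, mem_iUnion]
    constructor
    · rintro ⟨h1, h2⟩
      obtain ⟨k, hk⟩ := exists_departureIndex_eq h2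
      exact ⟨k, h1, hk, h2⟩
    · rintro ⟨k, h1, _, h2⟩
      exact ⟨h1, h2⟩
  rw [hU]
  exact h

lemma cond_hasSum_departureIndex [IsProbabilityMeasure P]
    (hN : IsMarkovChain P (psMatrix ρ) N) (n k : ℕ) :
    HasSum (fun m : ℕ => (cond P {ω | N 0 ω = some n}).real
        {ω | departureIndex N ω = ((k + 1 : ℕ) : WithTop ℕ) ∧ leftBehind N ω = some m})
      ((cond P {ω | N 0 ω = some n}).real
        {ω | departureIndex N ω = ((k + 1 : ℕ) : WithTop ℕ)}) := by
  simp only [cond_measureReal (hN.measurableSet_eq 0 (some n))]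
  refine HasSum.mul_left _ ?_
  have h := hasSum_measureReal_iUnion (P := P)
    (fun m => measurableSet_departure_event hN n k m) (fun m l hml => by
      refine Set.disjoint_left.mpr fun ω h1 h2 => hml ?_
      exact Option.some_injective _ (h1.2.2.symm.trans h2.2.2))
  have hU : {ω | N 0 ω = some n} ∩ {ω | departureIndex N ω = ((k + 1 : ℕ) : WithTop ℕ)} =
      ⋃ m : ℕ, {ω | N 0 ω = some n} ∩
        {ω | departureIndex N ω = ((k + 1 : ℕ) : WithTop ℕ) ∧ leftBehind N ω = some m} := by
    ext ω
    simp only [mem_inter_iff, mem_ofPred_eq, mem_iUnion]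
    constructor
    · rintro ⟨h1, h2⟩
      obtain ⟨m, hm⟩ := Option.ne_none_iff_exists'.mp
        (((departureIndex_eq_iff N ω (k + 1)).mp h2).2 k (by omega))
      exact ⟨m, h1, h2, by rw [leftBehind_of_departureIndex_eq h2]; exact hm⟩
    · rintro ⟨m, h1, h2, _⟩
      exact ⟨h1, h2⟩
  rw [hU]
  exact h

end Chain

theorem mainTheorem3 (ρ : ℝ) (hρ : 0 < ρ) (hρ1 : ρ < 1)
    {Ω : Type*} [MeasurableSpace Ω] (P : Measure Ω) [IsProbabilityMeasure P]
    (N : ℕ → Ω → Option ℕ) (hN : IsMarkovChain P (psMatrix ρ) N)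
    (n : ℕ) (hn : P {ω | N 0 ω = some n} ≠ 0) :
    -- the law of `ν` given `N_0 = n`
    (∀ m : ℕ,
      Integrable (fun x => psQ ρ m x * psQ ρ n x / (1 - x)) (psMeasure ρ) ∧
      (cond P {ω | N 0 ω = some n}).real {ω | leftBehind N ω = some m} =
        ρ ^ m / (1 + ρ) *
          ∫ x in psSupport ρ, psQ ρ m x * psQ ρ n x / (1 - x) ∂(psMeasure ρ)) ∧
    -- the law of `κ` given `N_0 = n`
    (∀ x ∈ psSupport ρ, Summable fun m : ℕ => psQ ρ m x * ρ ^ m) ∧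
    (∀ k : ℕ, 1 ≤ k →
      Integrable (fun x => x ^ (k - 1) * psGen ρ x ρ * psQ ρ n x) (psMeasure ρ) ∧
      (cond P {ω | N 0 ω = some n}).real {ω | departureIndex N ω = (k : WithTop ℕ)} =
        1 / (1 + ρ) *
          ∫ x in psSupport ρ, x ^ (k - 1) * psGen ρ x ρ * psQ ρ n x ∂(psMeasure ρ)) ∧
    -- the joint law of `κ` and `ν` given `N_0 = n`
    (∀ k m : ℕ, 1 ≤ k →
      Integrable (fun x => x ^ (k - 1) * psQ ρ m x * psQ ρ n x) (psMeasure ρ) ∧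
      (cond P {ω | N 0 ω = some n}).real
          {ω | departureIndex N ω = (k : WithTop ℕ) ∧ leftBehind N ω = some m} =
        ρ ^ m / (1 + ρ) *
          ∫ x in psSupport ρ, x ^ (k - 1) * psQ ρ m x * psQ ρ n x ∂(psMeasure ρ)) := by
  rw [restrict_psMeasure]
  refine ⟨fun m => ?_, fun x hx => summable_psQ_mul_pow hρ hρ1 hx, fun k hk => ?_,
    fun k m hk => ?_⟩
  · obtain ⟨h1, h2⟩ := hasSum_integral_psQ_div hρ hρ1 m n
    refine ⟨h1, (cond_hasSum_leftBehind hN n m).unique ?_⟩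
    simp only [cond_departure_event hρ hN hn]
    exact h2.mul_left _
  · obtain ⟨k, rfl⟩ := Nat.exists_eq_add_of_le' hk
    rw [Nat.add_sub_cancel]
    obtain ⟨h1, h2⟩ := hasSum_integral_psGen hρ hρ1 k n
    refine ⟨h1, (cond_hasSum_departureIndex hN n k).unique ?_⟩
    simp only [cond_departure_event hρ hN hn]
    refine (h2.mul_left (1 / (1 + ρ))).congr_fun fun m => ?_
    ring
  · obtain ⟨k, rfl⟩ := Nat.exists_eq_add_of_le' hk
    rw [Nat.add_sub_cancel]
    exact ⟨integrable_psMeasure_of_continuousOn hρ (((continuous_pow k).mul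
      (continuous_psQ ρ m)).mul (continuous_psQ ρ n)).continuousOn,
      cond_departure_event hρ hN hn k m⟩
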